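/- Let $1<p<\infty$, $s\in(0,1)$ and $N\ge 1$ with $sp<N$, and put $p^*=\frac{Np}{N-sp}$. For measurable $u:\mathbb{R}^N\to\mathbb{R}$ let \[ [u]_{s,p}^p=\int_{\mathbb{R}^N\times\mathbb{R}^N}\frac{|u(x)-u(y)|^p}{|x-y|^{N+sp}}\,dx\,dy , \qquad D^{s,p}(\mathbb{R}^N)=\{u\in L^{p^*}(\mathbb{R}^N):[u]_{s,p}<\infty\}. \] Let $B_1$ be the unit ball centred at the origin. There is a constant $C=C(N,p,s)>1$ such that every solution $u_1$ of the capacity problem \[ \inf\big\{[u]_{s,p}^p:\ u\in D^{s,p}(\mathbb{R}^N),\ u\ge\chi_{B_1}\ \text{a.e.}\big\} \] (that is, every admissible function attaining this infimum) satisfies \[ \frac{1}{C}\,|x|^{-\frac{N-sp}{p-1}}\ \le\ u_1(x)\ \le\ p^{\frac1{p-1}}\,|x|^{-\frac{N-sp}{p-1}} \] for almost every $x$ with $|x|\ge1$. Moreover, for every representative of $u_1$ that is continuous on $\{|x|\ge 1\}$, and for every representative that is radial and non-increasing in $|x|$, these bounds hold at every $x$ with $|x|\ge 1$. -/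

import Mathlib

open MeasureTheory

noncomputable section

/-- The `p`-th power `[u]_{s,p}^p` of the Gagliardo seminorm on `ℝᴺ`, with values in `[0,∞]`
(the integrand vanishes on the diagonal, a null set). -/
def gagliardoEnergy {N : ℕ} (s p : ℝ) (u : EuclideanSpace ℝ (Fin N) → ℝ) : ENNReal :=
  ∫⁻ z : EuclideanSpace ℝ (Fin N) × EuclideanSpace ℝ (Fin N),
    ENNReal.ofReal (|u z.1 - u z.2| ^ p / ‖z.1 - z.2‖ ^ ((N : ℝ) + s * p))

/-- The fractional critical exponent `p* = N p / (N - s p)`, used for `s p < N`. -/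
def criticalExponent (N : ℕ) (s p : ℝ) : ℝ := N * p / (N - s * p)

/-- The space `D^{s,p}(ℝᴺ)`, through representatives: functions in `L^{p*}(ℝᴺ)` with finite
Gagliardo seminorm. -/
def homogeneousSobolev (N : ℕ) (s p : ℝ) : Set (EuclideanSpace ℝ (Fin N) → ℝ) :=
  {u | MemLp u (ENNReal.ofReal (criticalExponent N s p)) volume ∧ gagliardoEnergy s p u < ⊤}

/-- The competitors of the capacity problem for the ball `B_R` centred at the origin: the
functions `u ∈ D^{s,p}(ℝᴺ)` with `u ≥ χ_{B_R}` almost everywhere. -/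
def capacityAdmissible (N : ℕ) (s p R : ℝ) : Set (EuclideanSpace ℝ (Fin N) → ℝ) :=
  {u | u ∈ homogeneousSobolev N s p ∧
    ∀ᵐ x, (Metric.ball (0 : EuclideanSpace ℝ (Fin N)) R).indicator (fun _ => (1 : ℝ)) x ≤ u x}

/-- `u` solves the problem `inf {[u]_{s,p}^p : u ∈ D^{s,p}(ℝᴺ), u ≥ χ_{B_R}}`, that is, `u` is a
competitor that attains the infimum: a capacitary potential of `B_R`. -/
def IsCapacitaryPotential {N : ℕ} (s p R : ℝ) (u : EuclideanSpace ℝ (Fin N) → ℝ) : Prop :=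
  u ∈ capacityAdmissible N s p R ∧
    gagliardoEnergy s p u = ⨅ v ∈ capacityAdmissible N s p R, gagliardoEnergy s p v

/-- `v` is radial and non-increasing: `v x` depends only on `‖x‖`, in a non-increasing way. -/
def IsRadialNonincreasing {N : ℕ} (v : EuclideanSpace ℝ (Fin N) → ℝ) : Prop :=
  ∀ x y, ‖x‖ ≤ ‖y‖ → v y ≤ v x

end

/-!
Write `E` for the energy `[·]_{s,p}^p`, `u` for a potential of the unit ball and `e = E(u)`, which
is positive and finite. The argument is variational throughout.

* *Uniqueness.* `E` is strictly convex up to constants, and a constant in `L^{p*}` vanishes, so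
  minimizers are unique (`IsCapacitaryPotential.ae_eq`). It therefore suffices to find a constant
  in the lower bound for one potential.
* *Monotonicity.* `E` is submodular: `E(max u v) + E(min u v) ≤ E(u) + E(v)`. By uniqueness,
  potentials of larger balls are larger, hence `u x ≤ u (c • ρ x)` a.e. for every linear isometry
  `ρ` and every `0 < c ≤ 1`. At Lebesgue points this says that `u` is radial and non-increasing
  (`IsCapacitaryPotential.exists_ae_antitone`); no rearrangement inequality is needed.
* *Truncation.* For `0 ≤ t ≤ 1`, `E(min u t) + E((u - t)₊) ≤ E(u)`, and `(u - t)₊ / (1 - t)` is a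
  competitor. With Bernoulli's inequality, `E(min u t) ≤ p t e`
  (`IsCapacitaryPotential.gagliardoEnergy_min_le`).
* *Upper bound.* By monotonicity, `min u t / t` with `t = u x` is a competitor for the ball of
  radius `R = ‖x‖`, whose capacity is `R ^ (N - s p) e`. Hence `R ^ (N - s p) ≤ p t ^ (1 - p)`.
* *Lower bound.* Let `v y = u (y / (M R))`, so that `v = 1` on the ball of radius `M R` and
  `E(v) = (M R) ^ (N - s p) e`. Convexity gives
  `e ≤ ∫∫ |u y - u z| ^ (p - 1) |v y - v z| / |y - z| ^ (N + s p)`. Pairs of points outside the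
  ball of radius `R` contribute at most `(p t e) ^ ((p - 1) / p) E(v) ^ (1 / p)`, by Hölder's
  inequality and the truncation estimate. In the other pairs one point lies in the ball of radius
  `R` and the other outside that of radius `M R`; by the upper bound they contribute at most a
  constant times `M ^ (-s p)`. For large `M` this is at most `e / 2`, which leaves
  `t ≥ R ^ (-(N - s p) / (p - 1)) / C`.
-/

section CapacitaryPotential

open Filter Topology Set
open scoped ENNReal

/-! ### Pointwise inequalities for `|·| ^ p` -/

lemma strictConvexOn_abs_rpow {p : ℝ} (hp : 1 < p) :
    StrictConvexOn ℝ univ fun x : ℝ => |x| ^ p := by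
  refine ⟨convex_univ, fun x _ y _ hxy a b ha hb hab => ?_⟩
  simp only [smul_eq_mul]
  have htri : |a * x + b * y| ≤ a * |x| + b * |y| := by
    refine (abs_add_le _ _).trans_eq ?_
    rw [abs_mul, abs_mul, abs_of_pos ha, abs_of_pos hb]
  rcases eq_or_ne |x| |y| with h | h
  · have hy : y = -x := by
      rcases abs_eq_abs.mp h with h | h
      · exact absurd h hxy
      · linarith
    subst hy
    have hx : 0 < |x| := abs_pos.mpr fun h0 => hxy (by simp [h0])
    have hlt : |a * x + b * -x| < |x| := by
      have : a * x + b * -x = (a - b) * x := by ring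
      rw [this, abs_mul]
      have : |a - b| < 1 := abs_lt.mpr ⟨by linarith, by linarith⟩
      nlinarith
    have := Real.rpow_lt_rpow (abs_nonneg _) hlt (by linarith : 0 < p)
    rw [abs_neg, ← add_mul, hab, one_mul]
    exact this
  · exact (Real.rpow_le_rpow (abs_nonneg _) htri (by linarith)).trans_lt
      ((strictConvexOn_rpow hp).2 (abs_nonneg x) (abs_nonneg y) h ha hb hab)

/-- Moving two points towards each other with a fixed sum decreases the sum of the values of a
convex function. -/
lemma ConvexOn.add_le_add_of_mem_Icc {f : ℝ → ℝ} (hf : ConvexOn ℝ univ f) {x y m : ℝ}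
    (hx : x ≤ m) (hy : m ≤ y) : f m + f (x + y - m) ≤ f x + f y := by
  rcases hx.eq_or_lt with rfl | hx
  · simp
  have hxy : 0 < y - x := by linarith
  have h0 : 0 ≤ (y - m) / (y - x) := div_nonneg (by linarith) hxy.le
  have h1 : 0 ≤ (m - x) / (y - x) := div_nonneg (by linarith) hxy.le
  have h2 : (y - m) / (y - x) + (m - x) / (y - x) = 1 := by field_simp; ring
  have e1 := hf.2 (mem_univ x) (mem_univ y) h0 h1 h2
  have e2 := hf.2 (mem_univ x) (mem_univ y) h1 h0 (by linarith)
  simp only [smul_eq_mul] at e1 e2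
  have r1 : (y - m) / (y - x) * x + (m - x) / (y - x) * y = m := by field_simp; ring
  have r2 : (m - x) / (y - x) * x + (y - m) / (y - x) * y = x + y - m := by field_simp; ring
  rw [r1] at e1
  rw [r2] at e2
  have : f x + f y = ((y - m) / (y - x) + (m - x) / (y - x)) * (f x + f y) := by
    rw [h2, one_mul]
  linarith

/-- Pointwise form of the submodularity of the Gagliardo energy. -/
lemma abs_max_sub_max_rpow_add_abs_min_sub_min_rpow_le {p : ℝ} (hp : 1 < p) (a b c d : ℝ) :
    |max a c - max b d| ^ p + |min a c - min b d| ^ p ≤ |a - b| ^ p + |c - d| ^ p := by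
  have hf := (strictConvexOn_abs_rpow hp).convexOn
  rcases le_total a c with h1 | h1 <;> rcases le_total b d with h2 | h2
  · simp only [max_eq_right h1, max_eq_right h2, min_eq_left h1, min_eq_left h2]
    linarith
  · simp only [max_eq_right h1, max_eq_left h2, min_eq_left h1, min_eq_right h2]
    have := hf.add_le_add_of_mem_Icc (x := a - b) (y := c - d) (m := c - b)
      (by linarith) (by linarith)
    rwa [show a - b + (c - d) - (c - b) = a - d by ring] at this
  · simp only [max_eq_left h1, max_eq_right h2, min_eq_right h1, min_eq_left h2]
    have := hf.add_le_add_of_mem_Icc (x := c - d) (y := a - b) (m := a - d)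
      (by linarith) (by linarith)
    rw [show c - d + (a - b) - (a - d) = c - b by ring] at this
    linarith
  · simp only [max_eq_left h1, max_eq_left h2, min_eq_right h1, min_eq_right h2]
    exact le_rfl

/-- The increments of `u` below and above height `t` have the same sign, and `x ↦ x ^ p` is
superadditive. -/
lemma abs_min_sub_min_rpow_add_abs_posPart_rpow_le {p : ℝ} (hp : 1 < p) (t a b : ℝ) :
    |min a t - min b t| ^ p + |max (a - t) 0 - max (b - t) 0| ^ p ≤ |a - b| ^ p := by
  have key : |min a t - min b t| + |max (a - t) 0 - max (b - t) 0| = |a - b| := by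
    have hsplit : ∀ r : ℝ, min r t + max (r - t) 0 = r := fun r => by
      rcases le_total r t with h | h
      · rw [min_eq_left h, max_eq_right (by linarith), add_zero]
      · rw [min_eq_right h, max_eq_left (by linarith)]; ring
    have ha := hsplit a
    have hb := hsplit b
    rcases le_total a b with h | h
    · have h1 : min a t ≤ min b t := min_le_min_right t h
      have h2 : max (a - t) 0 ≤ max (b - t) 0 := max_le_max_right 0 (by linarith)
      rw [abs_of_nonpos (by linarith), abs_of_nonpos (by linarith), abs_of_nonpos (by linarith)]
      linarith
    · have h1 : min b t ≤ min a t := min_le_min_right t h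
      have h2 : max (b - t) 0 ≤ max (a - t) 0 := max_le_max_right 0 (by linarith)
      rw [abs_of_nonneg (by linarith), abs_of_nonneg (by linarith), abs_of_nonneg (by linarith)]
      linarith
  have := NNReal.add_rpow_le_rpow_add (Real.nnabs (min a t - min b t))
    (Real.nnabs (max (a - t) 0 - max (b - t) 0)) hp.le
  rw [← NNReal.coe_le_coe] at this
  push_cast at this
  rwa [key] at this

/-- The gradient inequality for the convex function `x ↦ x ^ p` at the point `c`. -/
lemma rpow_add_mul_sub_le_rpow {p c a : ℝ} (hp : 1 < p) (hc : 0 ≤ c) (ha : 0 ≤ a) :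
    c ^ p + p * c ^ (p - 1) * (a - c) ≤ a ^ p := by
  rcases hc.eq_or_lt with rfl | hc
  · rw [Real.zero_rpow (by linarith), Real.zero_rpow (by linarith)]
    simpa using Real.rpow_nonneg ha p
  have hb := one_add_mul_self_le_rpow_one_add (s := a / c - 1) (p := p)
    (by have := div_nonneg ha hc.le; linarith) hp.le
  rw [show 1 + (a / c - 1) = a / c by ring, Real.div_rpow ha hc.le] at hb
  have hcp : 0 < c ^ p := Real.rpow_pos_of_pos hc p
  rw [le_div_iff₀ hcp] at hb
  have hcc : c ^ p = c ^ (p - 1) * c := by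
    rw [← Real.rpow_add_one hc.ne']; ring_nf
  refine le_trans (le_of_eq ?_) hb
  rw [hcc]
  field_simp

lemma add_rpow_le_two_rpow_mul {p a b : ℝ} (hp : 1 < p) (ha : 0 ≤ a) (hb : 0 ≤ b) :
    (a + b) ^ p ≤ 2 ^ p * (a ^ p + b ^ p) := by
  have h1 : a + b ≤ 2 * max a b := by
    have := le_max_left a b
    have := le_max_right a b
    linarith
  calc (a + b) ^ p ≤ (2 * max a b) ^ p := Real.rpow_le_rpow (by positivity) h1 (by linarith)
    _ = 2 ^ p * (max a b) ^ p := Real.mul_rpow (by norm_num) (le_max_of_le_left ha)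
    _ ≤ 2 ^ p * (a ^ p + b ^ p) := by
        gcongr
        rcases le_total a b with h | h
        · rw [max_eq_right h]; have := Real.rpow_nonneg ha p; linarith
        · rw [max_eq_left h]; have := Real.rpow_nonneg hb p; linarith

/-- First-order optimality: if the `L^p` norm of `a` does not exceed that of
`(1 - ε) a + ε b` for any `ε ∈ (0, 1)`, then `∫ a ^ p ≤ ∫ a ^ (p - 1) b`. -/
lemma lintegral_rpow_le_of_forall_convexCombo {X : Type*} [MeasurableSpace X] {μ : Measure X}
    {p : ℝ} (hp : 1 < p) {a b : X → ℝ} (ha : AEMeasurable a μ) (hb : AEMeasurable b μ)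
    (ha0 : ∀ x, 0 ≤ a x) (hb0 : ∀ x, 0 ≤ b x)
    (hfa : ∫⁻ x, ENNReal.ofReal (a x ^ p) ∂μ < ⊤) (hfb : ∫⁻ x, ENNReal.ofReal (b x ^ p) ∂μ < ⊤)
    (h : ∀ ε : ℝ, 0 < ε → ε < 1 → ∫⁻ x, ENNReal.ofReal (a x ^ p) ∂μ ≤
      ∫⁻ x, ENNReal.ofReal (((1 - ε) * a x + ε * b x) ^ p) ∂μ) :
    ∫⁻ x, ENNReal.ofReal (a x ^ p) ∂μ ≤ ∫⁻ x, ENNReal.ofReal (a x ^ (p - 1) * b x) ∂μ := by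
  have hp1 : 0 < p - 1 := by linarith
  set c : ℝ → X → ℝ := fun ε x => (1 - ε) * a x + ε * b x with hc
  have hcm : ∀ ε, AEMeasurable (c ε) μ := fun ε => (ha.const_mul _).add (hb.const_mul _)
  have hc0 : ∀ ε, 0 ≤ ε → ε ≤ 1 → ∀ x, 0 ≤ c ε x := fun ε h0 h1 x =>
    add_nonneg (mul_nonneg (by linarith) (ha0 x)) (mul_nonneg h0 (hb0 x))
  have hcle : ∀ ε, 0 ≤ ε → ε ≤ 1 → ∀ x, c ε x ≤ a x + b x := fun ε h0 h1 x => by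
    have := ha0 x; have := hb0 x
    simp only [hc]; nlinarith
  have hbound : ∀ ε, 0 ≤ ε → ε ≤ 1 → ∀ x, ∀ d, 0 ≤ d → d ≤ a x + b x →
      c ε x ^ (p - 1) * d ≤ (a x + b x) ^ p := fun ε h0 h1 x d hd0 hd => by
    have hs : 0 ≤ a x + b x := add_nonneg (ha0 x) (hb0 x)
    calc c ε x ^ (p - 1) * d ≤ (a x + b x) ^ (p - 1) * (a x + b x) := by
          gcongr
          · exact hc0 ε h0 h1 x
          · exact hcle ε h0 h1 x
      _ = (a x + b x) ^ p := by
          rw [← Real.rpow_add_one' hs (by linarith)]; ring_nf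
  have hfin : ∫⁻ x, ENNReal.ofReal ((a x + b x) ^ p) ∂μ ≠ ⊤ := by
    refine ne_of_lt (lt_of_le_of_lt (lintegral_mono fun x => ENNReal.ofReal_le_ofReal
      (add_rpow_le_two_rpow_mul hp (ha0 x) (hb0 x))) ?_)
    have : ∀ x, ENNReal.ofReal (2 ^ p * (a x ^ p + b x ^ p)) =
        ENNReal.ofReal (2 ^ p) * (ENNReal.ofReal (a x ^ p) + ENNReal.ofReal (b x ^ p)) := by
      intro x
      rw [ENNReal.ofReal_mul (by positivity), ENNReal.ofReal_add
        (Real.rpow_nonneg (ha0 x) p) (Real.rpow_nonneg (hb0 x) p)]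
    simp only [this]
    rw [lintegral_const_mul' _ _ ENNReal.ofReal_ne_top,
      lintegral_add_left' (ha.pow_const p).ennreal_ofReal]
    exact ENNReal.mul_lt_top ENNReal.ofReal_lt_top (ENNReal.add_lt_top.mpr ⟨hfa, hfb⟩)
  have hmeas : ∀ ε, ∀ d : X → ℝ, AEMeasurable d μ →
      AEMeasurable (fun x => ENNReal.ofReal (c ε x ^ (p - 1) * d x)) μ := fun ε d hd =>
    (((hcm ε).pow_const _).mul hd).ennreal_ofReal
  -- the inequality before passing to the limit `ε → 0`
  have hstep : ∀ ε : ℝ, 0 < ε → ε < 1 →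
      ∫⁻ x, ENNReal.ofReal (c ε x ^ (p - 1) * a x) ∂μ ≤
        ∫⁻ x, ENNReal.ofReal (c ε x ^ (p - 1) * b x) ∂μ := by
    intro ε h0 h1
    have hpe : 0 < p * ε := by positivity
    have hpt : ∀ x, ENNReal.ofReal (c ε x ^ p) +
        ENNReal.ofReal (p * ε) * ENNReal.ofReal (c ε x ^ (p - 1) * a x) ≤
        ENNReal.ofReal (a x ^ p) +
        ENNReal.ofReal (p * ε) * ENNReal.ofReal (c ε x ^ (p - 1) * b x) := by
      intro x
      have hcx := hc0 ε h0.le h1.le x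
      have hcp : 0 ≤ c ε x ^ (p - 1) := Real.rpow_nonneg hcx _
      rw [← ENNReal.ofReal_mul hpe.le, ← ENNReal.ofReal_mul hpe.le,
        ← ENNReal.ofReal_add (Real.rpow_nonneg hcx _)
          (mul_nonneg hpe.le (mul_nonneg hcp (ha0 x))),
        ← ENNReal.ofReal_add (Real.rpow_nonneg (ha0 x) _)
          (mul_nonneg hpe.le (mul_nonneg hcp (hb0 x)))]
      apply ENNReal.ofReal_le_ofReal
      have := rpow_add_mul_sub_le_rpow hp hcx (ha0 x)
      have hac : a x - c ε x = ε * (a x - b x) := by simp only [hc]; ring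
      rw [hac] at this
      linarith
    have hint := lintegral_mono (μ := μ) hpt
    rw [lintegral_add_left' ((hcm ε).pow_const p).ennreal_ofReal,
      lintegral_add_left' (ha.pow_const p).ennreal_ofReal,
      lintegral_const_mul' _ _ ENNReal.ofReal_ne_top,
      lintegral_const_mul' _ _ ENNReal.ofReal_ne_top] at hint
    have h2 := (add_le_add_left (h ε h0 h1) _).trans hint
    have h3 := (ENNReal.add_le_add_iff_left hfa.ne).mp h2
    exact (ENNReal.mul_le_mul_iff_right (by simpa using hpe) ENNReal.ofReal_ne_top).mp h3
  have hlim : Tendsto (fun n : ℕ => (1 : ℝ) / ((n : ℝ) + 2)) atTop (𝓝 0) := by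
    have := (tendsto_one_div_add_atTop_nhds_zero_nat (𝕜 := ℝ)).comp (tendsto_add_atTop_nat 1)
    refine this.congr fun n => ?_
    simp only [Function.comp]; push_cast; ring_nf
  have hε0 : ∀ n : ℕ, (0 : ℝ) < 1 / ((n : ℝ) + 2) := fun n => by positivity
  have hε1 : ∀ n : ℕ, (1 : ℝ) / ((n : ℝ) + 2) < 1 := fun n => by
    rw [div_lt_one (by positivity)]; have : (0 : ℝ) ≤ n := n.cast_nonneg; linarith
  have hconv : ∀ d : X → ℝ, AEMeasurable d μ → (∀ x, 0 ≤ d x) → (∀ x, d x ≤ a x + b x) →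
      Tendsto (fun n : ℕ => ∫⁻ x, ENNReal.ofReal (c (1 / ((n : ℝ) + 2)) x ^ (p - 1) * d x) ∂μ)
        atTop (𝓝 (∫⁻ x, ENNReal.ofReal (a x ^ (p - 1) * d x) ∂μ)) := by
    intro d hd hd0 hd1
    refine tendsto_lintegral_of_dominated_convergence'
      (fun x => ENNReal.ofReal ((a x + b x) ^ p)) (fun n => hmeas _ d hd)
      (fun n => Eventually.of_forall fun x => ENNReal.ofReal_le_ofReal
        (hbound _ (hε0 n).le (hε1 n).le x _ (hd0 x) (hd1 x))) hfin
      (Eventually.of_forall fun x => ?_)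
    refine ENNReal.tendsto_ofReal (Tendsto.mul_const _ (Tendsto.rpow_const ?_ (Or.inr hp1.le)))
    have : Tendsto (fun n : ℕ => (1 - 1 / ((n : ℝ) + 2)) * a x + 1 / ((n : ℝ) + 2) * b x) atTop
        (𝓝 ((1 - 0) * a x + 0 * b x)) :=
      ((tendsto_const_nhds.sub hlim).mul_const _).add (hlim.mul_const _)
    simpa using this
  have e : ∀ x, a x ^ p = a x ^ (p - 1) * a x := fun x => by
    rw [← Real.rpow_add_one' (ha0 x) (by linarith)]; ring_nf
  simp only [e]
  exact le_of_tendsto_of_tendsto'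
    (hconv a ha ha0 fun x => by have := hb0 x; linarith)
    (hconv b hb hb0 fun x => by have := ha0 x; linarith)
    fun n => hstep _ (hε0 n) (hε1 n)

/-! ### The energy as an integral over pairs of points -/

/-- The measure `|x - y|^{-(N + s p)} dx dy` on pairs of points, for which the energy of `u` is
the integral of `|u x - u y| ^ p`. -/
noncomputable def gagliardoMeasure (N : ℕ) (s p : ℝ) :
    Measure (EuclideanSpace ℝ (Fin N) × EuclideanSpace ℝ (Fin N)) :=
  volume.withDensity fun z => ENNReal.ofReal (1 / ‖z.1 - z.2‖ ^ ((N : ℝ) + s * p))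

variable {N : ℕ} {s p R : ℝ} {u v w : EuclideanSpace ℝ (Fin N) → ℝ}

lemma measurable_gagliardoKernel : Measurable
    fun z : EuclideanSpace ℝ (Fin N) × EuclideanSpace ℝ (Fin N) =>
      ENNReal.ofReal (1 / ‖z.1 - z.2‖ ^ ((N : ℝ) + s * p)) := by
  fun_prop

lemma lintegral_gagliardoMeasure
    (f : EuclideanSpace ℝ (Fin N) × EuclideanSpace ℝ (Fin N) → ℝ≥0∞) :
    ∫⁻ z, f z ∂(gagliardoMeasure N s p) =
      ∫⁻ z, ENNReal.ofReal (1 / ‖z.1 - z.2‖ ^ ((N : ℝ) + s * p)) * f z := by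
  rw [gagliardoMeasure, lintegral_withDensity_eq_lintegral_mul_non_measurable _
    measurable_gagliardoKernel (Eventually.of_forall fun z => ENNReal.ofReal_lt_top)]
  rfl

lemma gagliardoEnergy_eq_lintegral (u : EuclideanSpace ℝ (Fin N) → ℝ) :
    gagliardoEnergy s p u =
      ∫⁻ z, ENNReal.ofReal (|u z.1 - u z.2| ^ p) ∂(gagliardoMeasure N s p) := by
  rw [lintegral_gagliardoMeasure, gagliardoEnergy]
  refine lintegral_congr fun z => ?_
  rw [← ENNReal.ofReal_mul (by positivity)]
  congr 1
  ring

lemma gagliardoMeasure_absolutelyContinuous :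
    gagliardoMeasure N s p ≪ (volume : Measure (EuclideanSpace ℝ (Fin N))).prod volume :=
  withDensity_absolutelyContinuous _ _

lemma aemeasurable_gagliardoMeasure_fst {f : EuclideanSpace ℝ (Fin N) → ℝ} (h : AEMeasurable f) :
    AEMeasurable (fun z => f z.1) (gagliardoMeasure N s p) :=
  (h.comp_quasiMeasurePreserving Measure.quasiMeasurePreserving_fst).mono_ac
    gagliardoMeasure_absolutelyContinuous

lemma aemeasurable_abs_sub (hu : AEMeasurable u) :
    AEMeasurable (fun z => |u z.1 - u z.2|) (gagliardoMeasure N s p) := by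
  have h1 := aemeasurable_gagliardoMeasure_fst (s := s) (p := p) hu
  have h2 : AEMeasurable (fun z => u z.2) (gagliardoMeasure N s p) :=
    (hu.comp_quasiMeasurePreserving Measure.quasiMeasurePreserving_snd).mono_ac
      gagliardoMeasure_absolutelyContinuous
  exact (h1.sub h2).norm

lemma aemeasurable_energyDensity (hu : AEMeasurable u) :
    AEMeasurable (fun z => ENNReal.ofReal (|u z.1 - u z.2| ^ p)) (gagliardoMeasure N s p) :=
  ((aemeasurable_abs_sub hu).pow_const p).ennreal_ofReal

lemma gagliardoEnergy_mono (hp : 1 < p) (h : ∀ x y, |u x - u y| ≤ |v x - v y|) :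
    gagliardoEnergy s p u ≤ gagliardoEnergy s p v := by
  rw [gagliardoEnergy_eq_lintegral, gagliardoEnergy_eq_lintegral]
  refine lintegral_mono fun z => ENNReal.ofReal_le_ofReal ?_
  exact Real.rpow_le_rpow (abs_nonneg _) (h _ _) (by linarith)

lemma gagliardoEnergy_const_mul (c : ℝ) :
    gagliardoEnergy s p (fun x => c * u x) =
      ENNReal.ofReal (|c| ^ p) * gagliardoEnergy s p u := by
  rw [gagliardoEnergy_eq_lintegral, gagliardoEnergy_eq_lintegral,
    ← lintegral_const_mul' _ _ ENNReal.ofReal_ne_top]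
  refine lintegral_congr fun z => ?_
  rw [← ENNReal.ofReal_mul (by positivity), ← Real.mul_rpow (abs_nonneg _) (abs_nonneg _),
    ← abs_mul, mul_sub]

lemma gagliardoEnergy_max_add_min_le (hp : 1 < p) (hu : AEMeasurable u) (hv : AEMeasurable v) :
    gagliardoEnergy s p (fun x => max (u x) (v x)) + gagliardoEnergy s p (fun x => min (u x) (v x))
      ≤ gagliardoEnergy s p u + gagliardoEnergy s p v := by
  simp only [gagliardoEnergy_eq_lintegral]
  rw [← lintegral_add_left' (aemeasurable_energyDensity (hu.max hv)),
    ← lintegral_add_left' (aemeasurable_energyDensity hu)]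
  refine lintegral_mono fun z => ?_
  rw [← ENNReal.ofReal_add (by positivity) (by positivity),
    ← ENNReal.ofReal_add (by positivity) (by positivity)]
  exact ENNReal.ofReal_le_ofReal
    (abs_max_sub_max_rpow_add_abs_min_sub_min_rpow_le hp _ _ _ _)

lemma gagliardoEnergy_min_const_add_posPart_le (hp : 1 < p) (hu : AEMeasurable u) (t : ℝ) :
    gagliardoEnergy s p (fun x => min (u x) t) + gagliardoEnergy s p (fun x => max (u x - t) 0)
      ≤ gagliardoEnergy s p u := by
  simp only [gagliardoEnergy_eq_lintegral]
  rw [← lintegral_add_left' (aemeasurable_energyDensity (hu.min aemeasurable_const))]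
  refine lintegral_mono fun z => ?_
  rw [← ENNReal.ofReal_add (by positivity) (by positivity)]
  exact ENNReal.ofReal_le_ofReal (abs_min_sub_min_rpow_add_abs_posPart_rpow_le hp _ _ _)

/-- Pointwise convexity of the energy density. -/
lemma abs_convexCombo_sub_rpow_le (hp : 1 < p) {a b : ℝ} (ha : 0 ≤ a) (hb : 0 ≤ b)
    (hab : a + b = 1) (x y : EuclideanSpace ℝ (Fin N)) :
    |(a * u x + b * v x) - (a * u y + b * v y)| ^ p ≤
      a * |u x - u y| ^ p + b * |v x - v y| ^ p := by
  have := (strictConvexOn_abs_rpow hp).convexOn.2 (mem_univ (u x - u y)) (mem_univ (v x - v y))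
    ha hb hab
  simp only [smul_eq_mul] at this
  rwa [show a * (u x - u y) + b * (v x - v y) = a * u x + b * v x - (a * u y + b * v y) by ring]
    at this

lemma gagliardoEnergy_convexCombo_le (hp : 1 < p) (hu : AEMeasurable u)
    {a b : ℝ} (ha : 0 ≤ a) (hb : 0 ≤ b) (hab : a + b = 1) :
    gagliardoEnergy s p (fun x => a * u x + b * v x) ≤
      ENNReal.ofReal a * gagliardoEnergy s p u + ENNReal.ofReal b * gagliardoEnergy s p v := by
  simp only [gagliardoEnergy_eq_lintegral]
  rw [← lintegral_const_mul' _ _ ENNReal.ofReal_ne_top,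
    ← lintegral_const_mul' _ _ ENNReal.ofReal_ne_top,
    ← lintegral_add_left' ((aemeasurable_energyDensity hu).const_mul _)]
  refine lintegral_mono fun z => ?_
  rw [← ENNReal.ofReal_mul ha, ← ENNReal.ofReal_mul hb,
    ← ENNReal.ofReal_add (by positivity) (by positivity)]
  exact ENNReal.ofReal_le_ofReal (abs_convexCombo_sub_rpow_le hp ha hb hab _ _)

lemma ae_eq_const_of_ae_gagliardoMeasure
    (h : ∀ᵐ z ∂(gagliardoMeasure N s p), u z.1 = u z.2) : ∃ c, ∀ᵐ x, u x = c := by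
  have h' : ∀ᵐ z ∂((volume : Measure (EuclideanSpace ℝ (Fin N))).prod volume),
      u z.1 = u z.2 := by
    rw [gagliardoMeasure, ae_withDensity_iff measurable_gagliardoKernel] at h
    filter_upwards [h] with z hz
    by_cases hz0 : z.1 = z.2
    · rw [hz0]
    · refine hz ?_
      have : 0 < ‖z.1 - z.2‖ := norm_pos_iff.mpr (sub_ne_zero.mpr hz0)
      simp only [ne_eq, ENNReal.ofReal_eq_zero, not_le]
      positivity
  obtain ⟨x, hx⟩ := (Measure.ae_ae_of_ae_prod h').exists
  exact ⟨u x, hx.mono fun y hy => hy.symm⟩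

lemma criticalExponent_pos (hs0 : 0 < s) (hp : 1 < p) (hsp : s * p < N) :
    0 < criticalExponent N s p := by
  have h1 : 0 < s * p := by positivity
  have h2 : 0 < (N : ℝ) := h1.trans hsp
  exact div_pos (by positivity) (by linarith)

lemma volume_univ_eq_top (hs0 : 0 < s) (hp : 1 < p) (hsp : s * p < N) :
    (volume : Measure (EuclideanSpace ℝ (Fin N))) univ = ⊤ := by
  have h1 : 0 < s * p := by positivity
  have h2 : 0 < N := by exact_mod_cast h1.trans hsp
  have : Nonempty (Fin N) := ⟨⟨0, h2⟩⟩
  exact measure_univ_of_isAddLeftInvariant _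

/-- In `L^{p*}` the energy density determines the function: the only constant is zero. -/
lemma ae_eq_zero_of_ae_gagliardoMeasure (hs0 : 0 < s) (hp : 1 < p) (hsp : s * p < N)
    (hu : MemLp u (ENNReal.ofReal (criticalExponent N s p)))
    (h : ∀ᵐ z ∂(gagliardoMeasure N s p), u z.1 = u z.2) : ∀ᵐ x, u x = 0 := by
  obtain ⟨c, hc⟩ := ae_eq_const_of_ae_gagliardoMeasure h
  have hmem : MemLp (fun _ : EuclideanSpace ℝ (Fin N) => c)
      (ENNReal.ofReal (criticalExponent N s p)) := hu.ae_eq hc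
  rw [memLp_const_iff (by simpa using criticalExponent_pos hs0 hp hsp) ENNReal.ofReal_ne_top,
    volume_univ_eq_top hs0 hp hsp] at hmem
  have : c = 0 := by simpa using hmem
  simpa [this] using hc

/-! ### Competitors and uniqueness of the potential -/

lemma aemeasurable_of_mem_capacityAdmissible (hu : u ∈ capacityAdmissible N s p R) :
    AEMeasurable u := hu.1.1.1.aemeasurable

lemma IsCapacitaryPotential.gagliardoEnergy_le (hu : IsCapacitaryPotential s p R u)
    (hv : v ∈ capacityAdmissible N s p R) : gagliardoEnergy s p u ≤ gagliardoEnergy s p v :=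
  hu.2.trans_le (iInf₂_le v hv)

lemma IsCapacitaryPotential.of_gagliardoEnergy_le (hu : IsCapacitaryPotential s p R u)
    (hv : v ∈ capacityAdmissible N s p R) (h : gagliardoEnergy s p v ≤ gagliardoEnergy s p u) :
    IsCapacitaryPotential s p R v :=
  ⟨hv, le_antisymm (le_iInf₂ fun _ hw => h.trans (hu.gagliardoEnergy_le hw)) (iInf₂_le v hv)⟩

lemma mem_capacityAdmissible_of_abs_le (hu : u ∈ homogeneousSobolev N s p)
    (hw : AEMeasurable w) {C : ℝ} (hC : ∀ᵐ x, |w x| ≤ C * |u x|)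
    (hE : gagliardoEnergy s p w < ⊤)
    (h1 : ∀ᵐ x, x ∈ Metric.ball 0 R → 1 ≤ w x) (h0 : ∀ᵐ x, 0 ≤ w x) :
    w ∈ capacityAdmissible N s p R := by
  refine ⟨⟨hu.1.of_le_mul hw.aestronglyMeasurable hC, hE⟩, ?_⟩
  filter_upwards [h1, h0] with x h1 h0
  by_cases hx : x ∈ Metric.ball 0 R
  · simpa [indicator_of_mem hx] using h1 hx
  · simpa [indicator_of_notMem hx] using h0

lemma ae_nonneg_of_mem_capacityAdmissible (hu : u ∈ capacityAdmissible N s p R) :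
    ∀ᵐ x, 0 ≤ u x := by
  filter_upwards [hu.2] with x hx
  exact (indicator_nonneg (fun _ _ => zero_le_one) x).trans hx

lemma ae_one_le_of_mem_capacityAdmissible (hu : u ∈ capacityAdmissible N s p R) :
    ∀ᵐ x, x ∈ Metric.ball 0 R → 1 ≤ u x := by
  filter_upwards [hu.2] with x hx hxR
  simpa [indicator_of_mem hxR] using hx

lemma convexCombo_mem_capacityAdmissible (hp : 1 < p) (hu : u ∈ capacityAdmissible N s p R)
    (hv : v ∈ capacityAdmissible N s p R) {a b : ℝ} (ha : 0 ≤ a) (hb : 0 ≤ b)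
    (hab : a + b = 1) : (fun x => a * u x + b * v x) ∈ capacityAdmissible N s p R := by
  refine ⟨⟨(hu.1.1.const_mul a).add (hv.1.1.const_mul b), ?_⟩, ?_⟩
  · refine (gagliardoEnergy_convexCombo_le hp (aemeasurable_of_mem_capacityAdmissible hu)
      ha hb hab).trans_lt ?_
    exact ENNReal.add_lt_top.mpr ⟨ENNReal.mul_lt_top ENNReal.ofReal_lt_top hu.1.2,
      ENNReal.mul_lt_top ENNReal.ofReal_lt_top hv.1.2⟩
  · filter_upwards [hu.2, hv.2] with x h1 h2
    have h3 := mul_le_mul_of_nonneg_left h1 ha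
    have h4 := mul_le_mul_of_nonneg_left h2 hb
    have h5 : ∀ c : ℝ, a * c + b * c = c := fun c => by rw [← add_mul, hab, one_mul]
    rw [← h5 (indicator _ _ x)]
    exact add_le_add h3 h4

/-- Strict convexity of the energy makes the capacitary potential unique. -/
theorem IsCapacitaryPotential.ae_eq (hs0 : 0 < s) (hp : 1 < p) (hsp : s * p < N)
    (hu : IsCapacitaryPotential s p R u) (hv : IsCapacitaryPotential s p R v) :
    u =ᵐ[volume] v := by
  have hum := aemeasurable_of_mem_capacityAdmissible hu.1
  have hvm := aemeasurable_of_mem_capacityAdmissible hv.1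
  have hEv : gagliardoEnergy s p v = gagliardoEnergy s p u := hv.2.trans hu.2.symm
  have hmid := hu.gagliardoEnergy_le (convexCombo_mem_capacityAdmissible hp hu.1 hv.1
    (a := 1 / 2) (b := 1 / 2) (by norm_num) (by norm_num) (by norm_num))
  have hfin := (convexCombo_mem_capacityAdmissible hp hu.1 hv.1
    (a := 1 / 2) (b := 1 / 2) (by norm_num) (by norm_num) (by norm_num)).1.2
  have hsum : ∫⁻ z, ENNReal.ofReal (1 / 2 * |u z.1 - u z.2| ^ p + 1 / 2 * |v z.1 - v z.2| ^ p)
      ∂(gagliardoMeasure N s p) = gagliardoEnergy s p u := by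
    have : ∀ z : EuclideanSpace ℝ (Fin N) × EuclideanSpace ℝ (Fin N),
        ENNReal.ofReal (1 / 2 * |u z.1 - u z.2| ^ p + 1 / 2 * |v z.1 - v z.2| ^ p) =
        ENNReal.ofReal (1 / 2) * ENNReal.ofReal (|u z.1 - u z.2| ^ p) +
        ENNReal.ofReal (1 / 2) * ENNReal.ofReal (|v z.1 - v z.2| ^ p) := fun z => by
      rw [← ENNReal.ofReal_mul (by norm_num), ← ENNReal.ofReal_mul (by norm_num),
        ← ENNReal.ofReal_add (by positivity) (by positivity)]
    simp only [this]
    rw [lintegral_add_left' ((aemeasurable_energyDensity hum).const_mul _),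
      lintegral_const_mul' _ _ ENNReal.ofReal_ne_top,
      lintegral_const_mul' _ _ ENNReal.ofReal_ne_top, ← gagliardoEnergy_eq_lintegral,
      ← gagliardoEnergy_eq_lintegral, hEv, ← add_mul,
      ← ENNReal.ofReal_add (by norm_num) (by norm_num)]
    norm_num
  have hae := ae_eq_of_ae_le_of_lintegral_le (μ := gagliardoMeasure N s p)
    (f := fun z => ENNReal.ofReal
      (|(1 / 2 * u z.1 + 1 / 2 * v z.1) - (1 / 2 * u z.2 + 1 / 2 * v z.2)| ^ p))
    (g := fun z => ENNReal.ofReal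
      (1 / 2 * |u z.1 - u z.2| ^ p + 1 / 2 * |v z.1 - v z.2| ^ p))
    (Eventually.of_forall fun z => ENNReal.ofReal_le_ofReal
      (abs_convexCombo_sub_rpow_le hp (by norm_num) (by norm_num) (by norm_num) _ _))
    (by rw [gagliardoEnergy_eq_lintegral] at hfin; exact hfin.ne)
    ((((aemeasurable_abs_sub hum).pow_const p).const_mul _).add
      (((aemeasurable_abs_sub hvm).pow_const p).const_mul _)).ennreal_ofReal
    (by rw [hsum]; rwa [gagliardoEnergy_eq_lintegral (fun x => 1 / 2 * u x + 1 / 2 * v x)] at hmid)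
  have hdiff : ∀ᵐ z ∂(gagliardoMeasure N s p), (u - v) z.1 = (u - v) z.2 := by
    filter_upwards [hae] with z hz
    by_contra hne
    have hne' : u z.1 - u z.2 ≠ v z.1 - v z.2 := fun h => hne (by
      simp only [Pi.sub_apply]; linarith)
    have hlt := (strictConvexOn_abs_rpow hp).2 (mem_univ (u z.1 - u z.2))
      (mem_univ (v z.1 - v z.2)) hne' (by norm_num : (0 : ℝ) < 1 / 2)
      (by norm_num : (0 : ℝ) < 1 / 2) (by norm_num)
    simp only [smul_eq_mul] at hlt
    rw [ENNReal.ofReal_eq_ofReal_iff (by positivity) (by positivity),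
      show 1 / 2 * u z.1 + 1 / 2 * v z.1 - (1 / 2 * u z.2 + 1 / 2 * v z.2) =
        1 / 2 * (u z.1 - u z.2) + 1 / 2 * (v z.1 - v z.2) by ring] at hz
    exact hlt.ne hz
  filter_upwards [ae_eq_zero_of_ae_gagliardoMeasure hs0 hp hsp (hu.1.1.1.sub hv.1.1.1) hdiff]
    with x hx
  exact sub_eq_zero.mp hx

lemma IsCapacitaryPotential.gagliardoEnergy_ne_zero (hs0 : 0 < s) (hp : 1 < p)
    (hsp : s * p < N) (hR : 0 < R) (hu : IsCapacitaryPotential s p R u) :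
    gagliardoEnergy s p u ≠ 0 := by
  intro h0
  rw [gagliardoEnergy_eq_lintegral, lintegral_eq_zero_iff' (aemeasurable_energyDensity
    (aemeasurable_of_mem_capacityAdmissible hu.1))] at h0
  have hu0 := ae_eq_zero_of_ae_gagliardoMeasure hs0 hp hsp hu.1.1.1 (by
    filter_upwards [h0] with z hz
    by_contra hne
    have : 0 < |u z.1 - u z.2| := abs_pos.mpr (sub_ne_zero.mpr hne)
    have h1 : ENNReal.ofReal (|u z.1 - u z.2| ^ p) = 0 := hz
    rw [ENNReal.ofReal_eq_zero] at h1
    exact absurd h1 (not_le.mpr (by positivity)))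
  have hball : ∀ᵐ x : EuclideanSpace ℝ (Fin N), x ∉ Metric.ball 0 R := by
    filter_upwards [hu0, ae_one_le_of_mem_capacityAdmissible hu.1] with x h1 h2 h3
    have := h2 h3
    linarith
  have : volume (Metric.ball (0 : EuclideanSpace ℝ (Fin N)) R) = 0 := by
    have := ae_iff.mp hball
    simpa only [not_not, Set.ofPred_mem_eq] using this
  exact (Metric.measure_ball_pos volume _ hR).ne' this

/-- Truncation at height one does not increase the energy, so the potential is at most one. -/
lemma IsCapacitaryPotential.ae_le_one (hs0 : 0 < s) (hp : 1 < p)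
    (hsp : s * p < N) (hu : IsCapacitaryPotential s p R u) : ∀ᵐ x, u x ≤ 1 := by
  have hum := aemeasurable_of_mem_capacityAdmissible hu.1
  have hle : gagliardoEnergy s p (fun x => min (u x) 1) ≤ gagliardoEnergy s p u :=
    gagliardoEnergy_mono hp fun x y => by
      simpa using abs_min_sub_min_le_max (u x) 1 (u y) 1
  have hmem : (fun x => min (u x) 1) ∈ capacityAdmissible N s p R := by
    refine mem_capacityAdmissible_of_abs_le hu.1.1 (hum.min aemeasurable_const) (C := 1) ?_
      (hle.trans_lt hu.1.1.2) ?_ ?_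
    · filter_upwards [ae_nonneg_of_mem_capacityAdmissible hu.1] with x hx
      rw [abs_of_nonneg (le_min hx zero_le_one), abs_of_nonneg hx, one_mul]
      exact min_le_left _ _
    · filter_upwards [ae_one_le_of_mem_capacityAdmissible hu.1] with x hx hxR
      exact le_min (hx hxR) le_rfl
    · filter_upwards [ae_nonneg_of_mem_capacityAdmissible hu.1] with x hx
      exact le_min hx zero_le_one
  filter_upwards [hu.ae_eq hs0 hp hsp (hu.of_gagliardoEnergy_le hmem hle)] with x hx
  rw [hx]
  exact min_le_right _ _

/-! ### Similarities -/

lemma lintegral_comp_smul_addHaar {E : Type*} [NormedAddCommGroup E] [NormedSpace ℝ E]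
    [MeasurableSpace E] [BorelSpace E] [FiniteDimensional ℝ E] (μ : Measure E)
    [μ.IsAddHaarMeasure] (f : E → ℝ≥0∞) {c : ℝ} (hc : c ≠ 0) :
    ∫⁻ x, f (c • x) ∂μ = ENNReal.ofReal |(c ^ Module.finrank ℝ E)⁻¹| * ∫⁻ x, f x ∂μ := by
  change ∫⁻ x, f ((Homeomorph.smulOfNeZero c hc).toMeasurableEquiv x) ∂μ = _
  rw [← lintegral_map_equiv f (Homeomorph.smulOfNeZero c hc).toMeasurableEquiv]
  have : (⇑(Homeomorph.smulOfNeZero c hc).toMeasurableEquiv : E → E) = (c • ·) := rfl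
  rw [this, Measure.map_addHaar_smul μ hc, lintegral_smul_measure, smul_eq_mul]

lemma gagliardoEnergy_comp_linearIsometryEquiv
    (ρ : EuclideanSpace ℝ (Fin N) ≃ₗᵢ[ℝ] EuclideanSpace ℝ (Fin N)) :
    gagliardoEnergy s p (fun x => u (ρ x)) = gagliardoEnergy s p u := by
  have h := ρ.measurePreserving.prod ρ.measurePreserving
  have he : MeasurableEmbedding (Prod.map ρ ρ) :=
    ρ.toHomeomorph.measurableEmbedding.prodMap ρ.toHomeomorph.measurableEmbedding
  rw [gagliardoEnergy, gagliardoEnergy, Measure.volume_eq_prod]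
  refine Eq.trans (lintegral_congr fun z => ?_) (h.lintegral_comp_emb he _)
  simp only [Prod.map_fst, Prod.map_snd, ← map_sub, LinearIsometryEquiv.norm_map]

lemma gagliardoEnergy_comp_smul {c : ℝ} (hc : 0 < c) :
    gagliardoEnergy s p (fun x => u (c • x)) =
      ENNReal.ofReal (c ^ (s * p - N)) * gagliardoEnergy s p u := by
  have h := lintegral_comp_smul_addHaar
    ((volume : Measure (EuclideanSpace ℝ (Fin N))).prod volume)
    (fun z => ENNReal.ofReal (|u z.1 - u z.2| ^ p / ‖z.1 - z.2‖ ^ ((N : ℝ) + s * p))) hc.ne'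
  have hint : ∀ z : EuclideanSpace ℝ (Fin N) × EuclideanSpace ℝ (Fin N),
      ENNReal.ofReal (|u (c • z.1) - u (c • z.2)| ^ p / ‖z.1 - z.2‖ ^ ((N : ℝ) + s * p)) =
      ENNReal.ofReal (c ^ ((N : ℝ) + s * p)) * ENNReal.ofReal
        (|u (c • z).1 - u (c • z).2| ^ p / ‖(c • z).1 - (c • z).2‖ ^ ((N : ℝ) + s * p)) := by
    intro z
    rw [← ENNReal.ofReal_mul (by positivity), Prod.smul_fst, Prod.smul_snd, ← smul_sub, norm_smul,
      Real.norm_of_nonneg hc.le, Real.mul_rpow hc.le (norm_nonneg _)]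
    have : c ^ ((N : ℝ) + s * p) ≠ 0 := (Real.rpow_pos_of_pos hc _).ne'
    congr 1
    rw [← mul_div_assoc, mul_div_mul_left _ _ this]
  rw [gagliardoEnergy, gagliardoEnergy, Measure.volume_eq_prod]
  simp only [hint]
  rw [lintegral_const_mul' _ _ ENNReal.ofReal_ne_top, h, ← mul_assoc,
    ← ENNReal.ofReal_mul (by positivity)]
  congr 2
  rw [Module.finrank_prod, finrank_euclideanSpace_fin, abs_of_pos (by positivity),
    ← Real.rpow_natCast, ← Real.rpow_neg hc.le, ← Real.rpow_add hc]
  congr 1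
  push_cast
  ring

/-- The image of Lebesgue measure under the similarity `x ↦ c • ρ x`. -/
lemma map_smul_linearIsometryEquiv_volume {c : ℝ} (hc : 0 < c)
    (ρ : EuclideanSpace ℝ (Fin N) ≃ₗᵢ[ℝ] EuclideanSpace ℝ (Fin N)) :
    Measure.map (fun x => c • ρ x) volume =
      ENNReal.ofReal |(c ^ N)⁻¹| • (volume : Measure (EuclideanSpace ℝ (Fin N))) := by
  have h : (fun x => c • ρ x) = (c • ·) ∘ ρ := rfl
  rw [h, ← Measure.map_map (measurable_const_smul c) ρ.continuous.measurable,
    ρ.measurePreserving.map_eq, Measure.map_addHaar_smul _ hc.ne', finrank_euclideanSpace_fin]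

lemma measurableEmbedding_smul_linearIsometryEquiv {c : ℝ} (hc : 0 < c)
    (ρ : EuclideanSpace ℝ (Fin N) ≃ₗᵢ[ℝ] EuclideanSpace ℝ (Fin N)) :
    MeasurableEmbedding fun x => c • ρ x :=
  (ρ.toHomeomorph.trans (Homeomorph.smulOfNeZero c hc.ne')).measurableEmbedding

lemma quasiMeasurePreserving_smul_linearIsometryEquiv {c : ℝ} (hc : 0 < c)
    (ρ : EuclideanSpace ℝ (Fin N) ≃ₗᵢ[ℝ] EuclideanSpace ℝ (Fin N)) :
    Measure.QuasiMeasurePreserving fun x => c • ρ x := by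
  refine ⟨(measurableEmbedding_smul_linearIsometryEquiv hc ρ).measurable, ?_⟩
  rw [map_smul_linearIsometryEquiv_volume hc ρ]
  exact Measure.smul_absolutelyContinuous

lemma gagliardoEnergy_comp_similarity {c : ℝ} (hc : 0 < c)
    (ρ : EuclideanSpace ℝ (Fin N) ≃ₗᵢ[ℝ] EuclideanSpace ℝ (Fin N)) :
    gagliardoEnergy s p (fun x => u (c • ρ x)) =
      ENNReal.ofReal (c ^ (s * p - N)) * gagliardoEnergy s p u := by
  rw [gagliardoEnergy_comp_linearIsometryEquiv (u := fun x => u (c • x)) ρ,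
    gagliardoEnergy_comp_smul hc]

lemma comp_similarity_mem_capacityAdmissible {c : ℝ} (hc : 0 < c)
    (ρ : EuclideanSpace ℝ (Fin N) ≃ₗᵢ[ℝ] EuclideanSpace ℝ (Fin N))
    (hu : u ∈ capacityAdmissible N s p R) :
    (fun x => u (c • ρ x)) ∈ capacityAdmissible N s p (R / c) := by
  refine ⟨⟨?_, ?_⟩, ?_⟩
  · have : MemLp u (ENNReal.ofReal (criticalExponent N s p))
        (Measure.map (fun x => c • ρ x) volume) := by
      rw [map_smul_linearIsometryEquiv_volume hc ρ]
      exact hu.1.1.smul_measure ENNReal.ofReal_ne_top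
    exact (measurableEmbedding_smul_linearIsometryEquiv hc ρ).memLp_map_measure_iff.mp this
  · rw [gagliardoEnergy_comp_similarity hc]
    exact ENNReal.mul_lt_top ENNReal.ofReal_lt_top hu.1.2
  · filter_upwards [(quasiMeasurePreserving_smul_linearIsometryEquiv hc ρ).ae hu.2] with x hx
    have hiff : x ∈ Metric.ball (0 : EuclideanSpace ℝ (Fin N)) (R / c) ↔
        c • ρ x ∈ Metric.ball (0 : EuclideanSpace ℝ (Fin N)) R := by
      simp only [mem_ball_zero_iff, norm_smul, Real.norm_of_nonneg hc.le,
        LinearIsometryEquiv.norm_map, lt_div_iff₀ hc, mul_comm c]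
    refine le_trans (le_of_eq ?_) hx
    by_cases h : x ∈ Metric.ball (0 : EuclideanSpace ℝ (Fin N)) (R / c)
    · rw [indicator_of_mem h, indicator_of_mem (hiff.mp h)]
    · rw [indicator_of_notMem h, indicator_of_notMem fun h' => h (hiff.mpr h')]

/-- The capacity of a ball of radius `R` is `R ^ (N - s p)` times that of the unit ball. -/
lemma IsCapacitaryPotential.rpow_mul_gagliardoEnergy_le (hR : 0 < R)
    (hu : IsCapacitaryPotential s p 1 u) (hv : v ∈ capacityAdmissible N s p R) :
    ENNReal.ofReal (R ^ ((N : ℝ) - s * p)) * gagliardoEnergy s p u ≤ gagliardoEnergy s p v := by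
  have hv' := comp_similarity_mem_capacityAdmissible hR (LinearIsometryEquiv.refl ℝ _) hv
  rw [div_self hR.ne'] at hv'
  have h := hu.gagliardoEnergy_le hv'
  rw [gagliardoEnergy_comp_similarity hR] at h
  refine (mul_le_mul_right h _).trans_eq ?_
  rw [← mul_assoc, ← ENNReal.ofReal_mul (by positivity), ← Real.rpow_add hR]
  simp

lemma capacityAdmissible_anti {R' : ℝ} (h : R ≤ R') :
    capacityAdmissible N s p R' ⊆ capacityAdmissible N s p R := by
  refine fun u hu => ⟨hu.1, ?_⟩
  filter_upwards [hu.2] with x hx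
  exact (indicator_le_indicator_of_subset (Metric.ball_subset_ball h)
    (fun _ => zero_le_one) x).trans hx

/-! ### Comparison and monotonicity -/

/-- Comparison principle: `x ↦ u (c • ρ x)` is the potential of a larger concentric ball, hence
lies above `u`. -/
lemma IsCapacitaryPotential.ae_le_comp_similarity (hs0 : 0 < s) (hp : 1 < p) (hsp : s * p < N)
    (hu : IsCapacitaryPotential s p 1 u) {c : ℝ} (hc : 0 < c) (hc1 : c ≤ 1)
    (ρ : EuclideanSpace ℝ (Fin N) ≃ₗᵢ[ℝ] EuclideanSpace ℝ (Fin N)) :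
    ∀ᵐ x, u x ≤ u (c • ρ x) := by
  set w : EuclideanSpace ℝ (Fin N) → ℝ := fun x => u (c • ρ x) with hw
  have hwc : w ∈ capacityAdmissible N s p (1 / c) := comp_similarity_mem_capacityAdmissible hc ρ hu.1
  have hw1 : w ∈ capacityAdmissible N s p 1 :=
    capacityAdmissible_anti (by rw [le_div_iff₀ hc]; linarith) hwc
  have hum := aemeasurable_of_mem_capacityAdmissible hu.1
  have hwm := aemeasurable_of_mem_capacityAdmissible hwc
  have hsub := gagliardoEnergy_max_add_min_le (s := s) hp hum hwm
  have hfin : gagliardoEnergy s p u + gagliardoEnergy s p w < ⊤ :=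
    ENNReal.add_lt_top.mpr ⟨hu.1.1.2, hwc.1.2⟩
  have hmax : (fun x => max (u x) (w x)) ∈ capacityAdmissible N s p (1 / c) := by
    refine ⟨⟨hu.1.1.1.sup hwc.1.1, (le_self_add.trans hsub).trans_lt hfin⟩, ?_⟩
    filter_upwards [hwc.2] with x hx
    exact hx.trans (le_max_right _ _)
  have hmin : (fun x => min (u x) (w x)) ∈ capacityAdmissible N s p 1 := by
    refine ⟨⟨hu.1.1.1.inf hwc.1.1, (le_add_self.trans hsub).trans_lt hfin⟩, ?_⟩
    filter_upwards [hu.1.2, hw1.2] with x h1 h2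
    exact le_min h1 h2
  have hwE : gagliardoEnergy s p w ≤ gagliardoEnergy s p (fun x => max (u x) (w x)) := by
    refine le_trans (le_of_eq ?_) (hu.rpow_mul_gagliardoEnergy_le (by positivity) hmax)
    rw [hw, gagliardoEnergy_comp_similarity hc, one_div, Real.inv_rpow hc.le,
      ← Real.rpow_neg hc.le, neg_sub]
  have hle : gagliardoEnergy s p (fun x => min (u x) (w x)) ≤ gagliardoEnergy s p u := by
    have h1 := (add_le_add_left hwE (gagliardoEnergy s p (fun x => min (u x) (w x)))).trans hsub
    rw [add_comm (gagliardoEnergy s p u)] at h1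
    exact (ENNReal.add_le_add_iff_left hwc.1.2.ne).mp h1
  filter_upwards [hu.ae_eq hs0 hp hsp (hu.of_gagliardoEnergy_le hmin hle)] with x hx
  rw [hx]
  exact min_le_right _ _

lemma one_le_criticalExponent (hs0 : 0 < s) (hp : 1 < p) (hsp : s * p < N) :
    1 ≤ criticalExponent N s p := by
  have h1 : 0 < s * p := by positivity
  rw [criticalExponent, le_div_iff₀ (by linarith)]
  nlinarith

lemma setAverage_comp_similarity {c : ℝ} (hc : 0 < c)
    (ρ : EuclideanSpace ℝ (Fin N) ≃ₗᵢ[ℝ] EuclideanSpace ℝ (Fin N))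
    (y : EuclideanSpace ℝ (Fin N)) (δ : ℝ) :
    ⨍ x in Metric.closedBall y (δ / c), u (c • ρ x) =
      ⨍ x in Metric.closedBall (c • ρ y) δ, u x := by
  have he := measurableEmbedding_smul_linearIsometryEquiv hc ρ
  have hpre : (fun x => c • ρ x) ⁻¹' Metric.closedBall (c • ρ y) δ =
      Metric.closedBall y (δ / c) := by
    ext x
    simp only [mem_preimage, mem_closedBall_iff_norm, ← smul_sub, ← map_sub, norm_smul,
      Real.norm_of_nonneg hc.le, LinearIsometryEquiv.norm_map, le_div_iff₀ hc, mul_comm c]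
  have hk : (0 : ℝ) < |(c ^ N)⁻¹| := by positivity
  have hm := map_smul_linearIsometryEquiv_volume hc ρ
  have h1 : volume.real (Metric.closedBall y (δ / c)) =
      |(c ^ N)⁻¹| * volume.real (Metric.closedBall (c • ρ y) δ) := by
    rw [← hpre, measureReal_def, ← he.map_apply, hm, Measure.smul_apply, smul_eq_mul,
      ENNReal.toReal_mul, ENNReal.toReal_ofReal hk.le, measureReal_def]
  have h2 : ∫ x in Metric.closedBall y (δ / c), u (c • ρ x) =
      |(c ^ N)⁻¹| * ∫ x in Metric.closedBall (c • ρ y) δ, u x := by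
    rw [← hpre, ← he.setIntegral_map, hm, Measure.restrict_smul, integral_smul_measure,
      ENNReal.toReal_ofReal hk.le, smul_eq_mul]
  rw [setAverage_eq, setAverage_eq, h1, h2, smul_eq_mul, smul_eq_mul, mul_inv,
    mul_assoc, mul_left_comm _ |(c ^ N)⁻¹|, ← mul_assoc |(c ^ N)⁻¹|⁻¹, inv_mul_cancel₀ hk.ne',
    one_mul]

/-- On a conull set, namely at its Lebesgue points, the potential is radial and non-increasing.
A similarity of ratio at most one carries any Lebesgue point to any other one that is not farther
from the origin, and averages of `u` increase along it by comparison. -/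
theorem IsCapacitaryPotential.exists_ae_antitone (hs0 : 0 < s) (hp : 1 < p) (hsp : s * p < N)
    (hu : IsCapacitaryPotential s p 1 u) :
    ∃ G : Set (EuclideanSpace ℝ (Fin N)), (∀ᵐ x, x ∈ G) ∧
      ∀ x ∈ G, ∀ y ∈ G, ‖x‖ ≤ ‖y‖ → u y ≤ u x := by
  have hN : 0 < N := by
    have h1 : 0 < s * p := by positivity
    exact_mod_cast h1.trans hsp
  have : Nonempty (Fin N) := ⟨⟨0, hN⟩⟩
  have h1 : 1 ≤ ENNReal.ofReal (criticalExponent N s p) :=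
    ENNReal.one_le_ofReal.mpr (one_le_criticalExponent hs0 hp hsp)
  have hloc : LocallyIntegrable u := hu.1.1.1.locallyIntegrable h1
  -- the origin is discarded because no similarity carries another point to it
  have hleb := IsUnifLocDoublingMeasure.ae_tendsto_average volume hloc 1
  refine ⟨{x | x ≠ 0 ∧ ∀ δ : ℕ → ℝ, Tendsto δ atTop (𝓝[>] 0) →
    Tendsto (fun j => ⨍ y in Metric.closedBall x (δ j), u y) atTop (𝓝 (u x))}, ?_, ?_⟩
  · filter_upwards [hleb, Measure.ae_ne volume 0] with x hx hx0
    refine ⟨hx0, fun δ hδ => hx (fun _ => x) δ hδ ?_⟩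
    filter_upwards [hδ.eventually self_mem_nhdsWithin] with j hj
    rw [one_mul]
    exact Metric.mem_closedBall_self (le_of_lt hj)
  · rintro x ⟨hx0, hx⟩ y ⟨hy0, hy⟩ hxy
    have hxn : 0 < ‖x‖ := norm_pos_iff.mpr hx0
    have hyn : 0 < ‖y‖ := norm_pos_iff.mpr hy0
    set c : ℝ := ‖x‖ / ‖y‖ with hcdef
    have hc : 0 < c := by positivity
    have hc1 : c ≤ 1 := (div_le_one hyn).mpr hxy
    have hnorm : ‖y‖ = ‖c⁻¹ • x‖ := by
      rw [norm_smul, norm_inv, Real.norm_of_nonneg hc.le, hcdef]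
      field_simp
    set ρ := (ℝ ∙ (y - c⁻¹ • x))ᗮ.reflection with hρ
    have hT : c • ρ y = x := by
      rw [hρ, Submodule.reflection_sub hnorm, smul_smul, mul_inv_cancel₀ hc.ne', one_smul]
    have hcomp := hu.ae_le_comp_similarity hs0 hp hsp hc hc1 ρ
    have hw : LocallyIntegrable (fun x => u (c • ρ x)) :=
      (comp_similarity_mem_capacityAdmissible hc ρ hu.1).1.1.locallyIntegrable h1
    have hδ : Tendsto (fun n : ℕ => 1 / ((n : ℝ) + 1)) atTop (𝓝[>] 0) :=
      tendsto_nhdsWithin_iff.mpr ⟨tendsto_one_div_add_atTop_nhds_zero_nat,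
        Eventually.of_forall fun n => by simp only [mem_Ioi]; positivity⟩
    have hδc : Tendsto (fun n : ℕ => 1 / ((n : ℝ) + 1) / c) atTop (𝓝[>] 0) := by
      refine tendsto_nhdsWithin_iff.mpr ⟨?_, Eventually.of_forall fun n => by
        simp only [mem_Ioi]; positivity⟩
      simpa using (tendsto_one_div_add_atTop_nhds_zero_nat (𝕜 := ℝ)).div_const c
    refine le_of_tendsto_of_tendsto' (hy _ hδc) (hx _ hδ) fun n => ?_
    have havg := setAverage_comp_similarity (u := u) hc ρ y (1 / ((n : ℝ) + 1))
    rw [hT] at havg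
    rw [← havg, setAverage_eq, setAverage_eq]
    refine smul_le_smul_of_nonneg_left ?_ (by positivity)
    exact setIntegral_mono_ae (hloc.integrableOn_isCompact (isCompact_closedBall _ _))
      (hw.integrableOn_isCompact (isCompact_closedBall _ _)) hcomp

/-! ### The upper bound -/

/-- Energy of the truncation at height `t`. The function `(u - t)₊ / (1 - t)` is a competitor, so
that the part of `u` above `t` carries at least `(1 - t) ^ p ≥ 1 - p t` of the energy. -/
lemma IsCapacitaryPotential.gagliardoEnergy_min_le (hp : 1 < p)
    (hu : IsCapacitaryPotential s p 1 u) {t : ℝ} (ht0 : 0 ≤ t) (ht1 : t ≤ 1) :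
    gagliardoEnergy s p (fun x => min (u x) t) ≤
      ENNReal.ofReal (p * t) * gagliardoEnergy s p u := by
  have hum := aemeasurable_of_mem_capacityAdmissible hu.1
  set P : EuclideanSpace ℝ (Fin N) → ℝ := fun x => max (u x - t) 0 with hP
  have hsplit := gagliardoEnergy_min_const_add_posPart_le (s := s) hp hum t
  have hPE : gagliardoEnergy s p P < ⊤ := (le_add_self.trans hsplit).trans_lt hu.1.1.2
  have hup : ENNReal.ofReal ((1 - t) ^ p) * gagliardoEnergy s p u ≤ gagliardoEnergy s p P := by
    rcases ht1.eq_or_lt with rfl | ht1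
    · rw [sub_self, Real.zero_rpow (by linarith), ENNReal.ofReal_zero, zero_mul]
      exact zero_le
    have h1t : 0 < 1 - t := by linarith
    have hE := gagliardoEnergy_const_mul (s := s) (p := p) (u := P) (1 - t)⁻¹
    have hmem : (fun x => (1 - t)⁻¹ * P x) ∈ capacityAdmissible N s p 1 := by
      refine mem_capacityAdmissible_of_abs_le hu.1.1
        (((hum.sub_const t).max aemeasurable_const).const_mul _) (C := (1 - t)⁻¹) ?_ ?_ ?_ ?_
      · filter_upwards [ae_nonneg_of_mem_capacityAdmissible hu.1] with x hx
        rw [abs_mul, abs_of_pos (inv_pos.mpr h1t), abs_of_nonneg hx,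
          abs_of_nonneg (le_max_right _ _)]
        exact mul_le_mul_of_nonneg_left (max_le (by linarith) hx) (by positivity)
      · rw [hE]
        exact ENNReal.mul_lt_top ENNReal.ofReal_lt_top hPE
      · filter_upwards [ae_one_le_of_mem_capacityAdmissible hu.1] with x hx hxR
        have h1 : 1 - t ≤ P x := le_max_of_le_left (by linarith [hx hxR])
        rw [inv_mul_eq_div, le_div_iff₀ h1t]
        linarith
      · exact Eventually.of_forall fun x =>
          mul_nonneg (by positivity) (le_max_right _ _)
    have h := hu.gagliardoEnergy_le hmem
    rw [hE] at h
    refine (mul_le_mul_right h _).trans_eq ?_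
    rw [← mul_assoc, ← ENNReal.ofReal_mul (by positivity), abs_of_pos (by positivity),
      ← Real.mul_rpow (by positivity) (by positivity), mul_inv_cancel₀ h1t.ne', Real.one_rpow,
      ENNReal.ofReal_one, one_mul]
  have hbern : 1 ≤ p * t + (1 - t) ^ p := by
    have := one_add_mul_self_le_rpow_one_add (s := -t) (by linarith) hp.le
    rw [← sub_eq_add_neg] at this
    linarith
  have hle : gagliardoEnergy s p u ≤ ENNReal.ofReal (p * t) * gagliardoEnergy s p u +
      ENNReal.ofReal ((1 - t) ^ p) * gagliardoEnergy s p u := by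
    rw [← add_mul, ← ENNReal.ofReal_add (by positivity) (Real.rpow_nonneg (by linarith) _)]
    exact le_mul_of_one_le_left' (ENNReal.one_le_ofReal.mpr hbern)
  have hfin : ENNReal.ofReal ((1 - t) ^ p) * gagliardoEnergy s p u ≠ ⊤ :=
    (ENNReal.mul_lt_top ENNReal.ofReal_lt_top hu.1.1.2).ne
  refine (ENNReal.add_le_add_iff_right hfin).mp ?_
  exact (add_le_add_right hup _).trans (hsplit.trans hle)

/-- The upper bound: `min u t / t` with `t = u x` is a competitor for the ball of radius `‖x‖`. -/
lemma IsCapacitaryPotential.ae_rpow_le (hs0 : 0 < s) (hp : 1 < p) (hsp : s * p < N)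
    (hu : IsCapacitaryPotential s p 1 u) :
    ∀ᵐ x, u x ^ (p - 1) ≤ p * ‖x‖ ^ (-((N : ℝ) - s * p)) := by
  obtain ⟨G, hGae, hG⟩ := hu.exists_ae_antitone hs0 hp hsp
  have hN : 0 < N := by
    have h1 : 0 < s * p := by positivity
    exact_mod_cast h1.trans hsp
  have : Nonempty (Fin N) := ⟨⟨0, hN⟩⟩
  have hum := aemeasurable_of_mem_capacityAdmissible hu.1
  filter_upwards [hGae, Measure.ae_ne volume 0, hu.ae_le_one hs0 hp hsp,
    ae_nonneg_of_mem_capacityAdmissible hu.1] with x hxG hx0 hx1 hxn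
  have hR : 0 < ‖x‖ := norm_pos_iff.mpr hx0
  rcases hxn.eq_or_lt with h0 | ht
  · rw [← h0, Real.zero_rpow (by linarith)]
    positivity
  have hE := gagliardoEnergy_const_mul (s := s) (p := p)
    (u := fun y => min (u y) (u x)) (u x)⁻¹
  have hmin := hu.gagliardoEnergy_min_le hp hxn hx1
  have hmem : (fun y => (u x)⁻¹ * min (u y) (u x)) ∈ capacityAdmissible N s p ‖x‖ := by
    refine mem_capacityAdmissible_of_abs_le hu.1.1
      ((hum.min aemeasurable_const).const_mul _) (C := (u x)⁻¹) ?_ ?_ ?_ ?_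
    · filter_upwards [ae_nonneg_of_mem_capacityAdmissible hu.1] with y hy
      rw [abs_mul, abs_of_pos (inv_pos.mpr ht), abs_of_nonneg hy, abs_of_nonneg (le_min hy hxn)]
      exact mul_le_mul_of_nonneg_left (min_le_left _ _) (by positivity)
    · rw [hE]
      exact ENNReal.mul_lt_top ENNReal.ofReal_lt_top (hmin.trans_lt
        (ENNReal.mul_lt_top ENNReal.ofReal_lt_top hu.1.1.2))
    · filter_upwards [hGae] with y hy hyR
      rw [min_eq_right (hG y hy x hxG (mem_ball_zero_iff.mp hyR).le), inv_mul_cancel₀ ht.ne']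
    · filter_upwards [ae_nonneg_of_mem_capacityAdmissible hu.1] with y hy
      exact mul_nonneg (by positivity) (le_min hy hxn)
  have h := hu.rpow_mul_gagliardoEnergy_le hR hmem
  rw [hE] at h
  have h2 := h.trans (mul_le_mul_right hmin _)
  rw [← mul_assoc, ENNReal.mul_le_mul_iff_left
    (hu.gagliardoEnergy_ne_zero hs0 hp hsp zero_lt_one) hu.1.1.2.ne,
    ← ENNReal.ofReal_mul (by positivity), ENNReal.ofReal_le_ofReal_iff (by positivity),
    abs_of_pos (by positivity), Real.inv_rpow hxn] at h2
  have htp : 0 < u x ^ p := Real.rpow_pos_of_pos ht p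
  have hRp : 0 < ‖x‖ ^ ((N : ℝ) - s * p) := Real.rpow_pos_of_pos hR _
  rw [inv_mul_eq_div, le_div_iff₀ htp] at h2
  have hpp : u x ^ p = u x ^ (p - 1) * u x := by
    rw [← Real.rpow_add_one ht.ne']; ring_nf
  rw [hpp] at h2
  rw [Real.rpow_neg hR.le, ← div_eq_mul_inv, le_div_iff₀ hRp]
  refine le_of_mul_le_mul_right ?_ ht
  linarith

/-! ### First variation of the energy -/

/-- A form of the Euler-Lagrange inequality tested with a competitor `v`, in which only the absolute
values of the increments enter. -/
lemma IsCapacitaryPotential.gagliardoEnergy_le_lintegral (hp : 1 < p)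
    (hu : IsCapacitaryPotential s p R u) (hv : v ∈ capacityAdmissible N s p R) :
    gagliardoEnergy s p u ≤ ∫⁻ z, ENNReal.ofReal
      (|u z.1 - u z.2| ^ (p - 1) * |v z.1 - v z.2|) ∂(gagliardoMeasure N s p) := by
  have hum := aemeasurable_of_mem_capacityAdmissible hu.1
  have hvm := aemeasurable_of_mem_capacityAdmissible hv
  have hfu := hu.1.1.2
  have hfv := hv.1.2
  rw [gagliardoEnergy_eq_lintegral] at hfu hfv ⊢
  refine lintegral_rpow_le_of_forall_convexCombo hp (aemeasurable_abs_sub hum)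
    (aemeasurable_abs_sub hvm) (fun _ => abs_nonneg _) (fun _ => abs_nonneg _) hfu hfv
    fun ε h0 h1 => ?_
  have h := hu.gagliardoEnergy_le (convexCombo_mem_capacityAdmissible hp hu.1 hv
    (a := 1 - ε) (b := ε) (by linarith) h0.le (by ring))
  rw [gagliardoEnergy_eq_lintegral, gagliardoEnergy_eq_lintegral] at h
  refine h.trans (lintegral_mono fun z => ENNReal.ofReal_le_ofReal ?_)
  refine Real.rpow_le_rpow (abs_nonneg _) ?_ (by linarith)
  calc |(1 - ε) * u z.1 + ε * v z.1 - ((1 - ε) * u z.2 + ε * v z.2)|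
      = |(1 - ε) * (u z.1 - u z.2) + ε * (v z.1 - v z.2)| := by ring_nf
    _ ≤ |(1 - ε) * (u z.1 - u z.2)| + |ε * (v z.1 - v z.2)| := abs_add_le _ _
    _ = (1 - ε) * |u z.1 - u z.2| + ε * |v z.1 - v z.2| := by
        rw [abs_mul, abs_mul, abs_of_nonneg (by linarith : 0 ≤ 1 - ε), abs_of_pos h0]

/-! ### Interaction of a ball with the complement of a larger ball -/

/-- The function `‖x‖ ^ (-(N - s p))` on the unit ball. -/
noncomputable def innerProfile (N : ℕ) (s p : ℝ) (x : EuclideanSpace ℝ (Fin N)) : ℝ≥0∞ :=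
  ENNReal.ofReal ((Metric.ball 0 1).indicator (fun x => ‖x‖ ^ (-((N : ℝ) - s * p))) x)

/-- The function `‖x‖ ^ (-(N + s p))` outside the unit ball. -/
noncomputable def tailProfile (N : ℕ) (s p : ℝ) (x : EuclideanSpace ℝ (Fin N)) : ℝ≥0∞ :=
  ENNReal.ofReal ((Metric.ball 0 1)ᶜ.indicator (fun x => ‖x‖ ^ (-((N : ℝ) + s * p))) x)

lemma measurable_innerProfile : Measurable (innerProfile N s p) :=
  (Measurable.indicator (by fun_prop) measurableSet_ball).ennreal_ofReal

lemma measurable_tailProfile : Measurable (tailProfile N s p) :=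
  (Measurable.indicator (by fun_prop) measurableSet_ball.compl).ennreal_ofReal

lemma lintegral_innerProfile_lt_top (hs0 : 0 < s) (hp : 1 < p) (hsp : s * p < N) :
    ∫⁻ x, innerProfile N s p x < ⊤ := by
  have h1 : 0 < s * p := by positivity
  have hN : 0 < N := by exact_mod_cast h1.trans hsp
  have h := integrableOn_ball_of_norm_le_rpow (μ := (volume : Measure (EuclideanSpace ℝ (Fin N))))
    (f := fun x => ‖x‖ ^ (-((N : ℝ) - s * p))) (C := 1) (α := (N : ℝ) - s * p) (r := 1)
    (by rw [finrank_euclideanSpace_fin]; exact hN)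
    (by rw [finrank_euclideanSpace_fin]; linarith)
    (Eventually.of_forall fun x => by rw [Real.norm_of_nonneg (by positivity), one_mul])
    (Measurable.aestronglyMeasurable (by fun_prop))
  rw [← integrable_indicator_iff measurableSet_ball] at h
  exact h.lintegral_lt_top

lemma lintegral_tailProfile_lt_top (hs0 : 0 < s) (hp : 1 < p) :
    ∫⁻ x, tailProfile N s p x < ⊤ := by
  have h1 : 0 < s * p := by positivity
  have h := (integrable_one_add_norm (μ := (volume : Measure (EuclideanSpace ℝ (Fin N))))
    (r := (N : ℝ) + s * p) (by rw [finrank_euclideanSpace_fin]; linarith)).const_mul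
    (2 ^ ((N : ℝ) + s * p))
  refine (lintegral_mono fun x => ENNReal.ofReal_le_ofReal ?_).trans_lt h.lintegral_lt_top
  by_cases hx : x ∈ (Metric.ball (0 : EuclideanSpace ℝ (Fin N)) 1)ᶜ
  swap
  · rw [indicator_of_notMem hx]
    positivity
  rw [indicator_of_mem hx]
  have hx1 : 1 ≤ ‖x‖ := by simpa using hx
  have hq : 0 ≤ (N : ℝ) + s * p := by positivity
  rw [Real.rpow_neg (norm_nonneg _), Real.rpow_neg (by positivity), ← div_eq_mul_inv,
    ← Real.div_rpow (by norm_num) (by positivity), ← Real.inv_rpow (norm_nonneg _)]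
  refine Real.rpow_le_rpow (by positivity) ?_ hq
  rw [inv_eq_one_div, div_le_div_iff₀ (by linarith) (by linarith)]
  linarith

lemma lintegral_comp_inv_smul {c : ℝ} (hc : 0 < c) (f : EuclideanSpace ℝ (Fin N) → ℝ≥0∞) :
    ∫⁻ x, f (c⁻¹ • x) = ENNReal.ofReal (c ^ (N : ℝ)) * ∫⁻ x, f x := by
  rw [lintegral_comp_smul_addHaar _ _ (inv_ne_zero hc.ne'), finrank_euclideanSpace_fin,
    abs_of_pos (by positivity), inv_pow, inv_inv, Real.rpow_natCast]

/-- A majorant for the interaction of the ball of radius `R` with the complement of the ball of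
radius `M R`, when the integrand is `‖x‖ ^ (-(N - s p))`. -/
noncomputable def interactionMajorant (N : ℕ) (s p M R : ℝ)
    (z : EuclideanSpace ℝ (Fin N) × EuclideanSpace ℝ (Fin N)) : ℝ≥0∞ :=
  ENNReal.ofReal (2 ^ ((N : ℝ) + s * p) * p * (M * R) ^ (-((N : ℝ) + s * p)) *
    R ^ (-((N : ℝ) - s * p))) *
    (innerProfile N s p (R⁻¹ • z.1) * tailProfile N s p ((M * R)⁻¹ • z.2))

lemma measurable_interactionMajorant {M : ℝ} : Measurable (interactionMajorant N s p M R) :=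
  ((measurable_innerProfile.comp (measurable_fst.const_smul R⁻¹)).mul
    (measurable_tailProfile.comp (measurable_snd.const_smul (M * R)⁻¹))).const_mul _

lemma lintegral_interactionMajorant (hp : 1 < p) {M : ℝ} (hM : 0 < M) (hR : 0 < R) :
    ∫⁻ z, interactionMajorant N s p M R z ∂((volume : Measure _).prod volume) =
      ENNReal.ofReal (2 ^ ((N : ℝ) + s * p) * p * M ^ (-(s * p))) *
        ((∫⁻ x, innerProfile N s p x) * ∫⁻ x, tailProfile N s p x) := by
  have hMR : 0 < M * R := by positivity
  have hp0 : 0 < p := by linarith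
  simp only [interactionMajorant]
  rw [lintegral_const_mul' _ _ ENNReal.ofReal_ne_top,
    lintegral_prod_mul (f := fun x => innerProfile N s p (R⁻¹ • x))
      (g := fun x => tailProfile N s p ((M * R)⁻¹ • x))
      (measurable_innerProfile.comp (measurable_const_smul _)).aemeasurable
      (measurable_tailProfile.comp (measurable_const_smul _)).aemeasurable,
    lintegral_comp_inv_smul hR, lintegral_comp_inv_smul hMR, mul_mul_mul_comm, ← mul_assoc,
    ← ENNReal.ofReal_mul (by positivity), ← ENNReal.ofReal_mul (by positivity)]
  congr 2
  have e1 : (M * R) ^ (-((N : ℝ) + s * p)) * (M * R) ^ (N : ℝ) = (M * R) ^ (-(s * p)) := by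
    rw [← Real.rpow_add hMR]; ring_nf
  have e2 : R ^ (-((N : ℝ) - s * p)) * R ^ (N : ℝ) = R ^ (s * p) := by
    rw [← Real.rpow_add hR]; ring_nf
  have e3 : R ^ (-(s * p)) * R ^ (s * p) = 1 := by
    rw [← Real.rpow_add hR]; simp
  calc 2 ^ ((N : ℝ) + s * p) * p * (M * R) ^ (-((N : ℝ) + s * p)) * R ^ (-((N : ℝ) - s * p)) *
      (R ^ (N : ℝ) * (M * R) ^ (N : ℝ))
      = 2 ^ ((N : ℝ) + s * p) * p * ((M * R) ^ (-((N : ℝ) + s * p)) * (M * R) ^ (N : ℝ)) *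
        (R ^ (-((N : ℝ) - s * p)) * R ^ (N : ℝ)) := by ring
    _ = 2 ^ ((N : ℝ) + s * p) * p * M ^ (-(s * p)) * (R ^ (-(s * p)) * R ^ (s * p)) := by
        rw [e1, e2, Real.mul_rpow hM.le hR.le]; ring
    _ = _ := by rw [e3, mul_one]

lemma kernel_mul_le_interactionMajorant (hs0 : 0 < s) (hp : 1 < p) {M a : ℝ} (hM : 2 ≤ M)
    (hR : 0 < R) {z : EuclideanSpace ℝ (Fin N) × EuclideanSpace ℝ (Fin N)}
    (h1 : ‖z.1‖ < R) (h2 : M * R ≤ ‖z.2‖) (ha : a ≤ p * ‖z.1‖ ^ (-((N : ℝ) - s * p))) :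
    ENNReal.ofReal (1 / ‖z.1 - z.2‖ ^ ((N : ℝ) + s * p)) * ENNReal.ofReal a ≤
      interactionMajorant N s p M R z := by
  have hMR : 0 < M * R := by positivity
  have hp0 : 0 < p := by linarith
  have hq : 0 ≤ (N : ℝ) + s * p := by positivity
  have hz2 : 0 < ‖z.2‖ := hMR.trans_le h2
  have m1 : R⁻¹ • z.1 ∈ Metric.ball (0 : EuclideanSpace ℝ (Fin N)) 1 := by
    rw [mem_ball_zero_iff, norm_smul, Real.norm_of_nonneg (by positivity), inv_mul_eq_div,
      div_lt_one hR]
    exact h1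
  have m2 : (M * R)⁻¹ • z.2 ∈ (Metric.ball (0 : EuclideanSpace ℝ (Fin N)) 1)ᶜ := by
    rw [mem_compl_iff, mem_ball_zero_iff, norm_smul, Real.norm_of_nonneg (by positivity),
      inv_mul_eq_div, div_lt_one hMR, not_lt]
    exact h2
  rw [interactionMajorant, innerProfile, tailProfile, indicator_of_mem m1, indicator_of_mem m2,
    ← ENNReal.ofReal_mul (by positivity), ← ENNReal.ofReal_mul (by positivity),
    ← ENNReal.ofReal_mul (by positivity)]
  apply ENNReal.ofReal_le_ofReal
  -- `‖z.2‖ ≥ 2 R > 2 ‖z.1‖`, so the distance is comparable to `‖z.2‖`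
  have hdist : ‖z.2‖ / 2 ≤ ‖z.1 - z.2‖ := by
    have h3 : ‖z.2‖ - ‖z.1‖ ≤ ‖z.1 - z.2‖ := by
      rw [norm_sub_rev]; exact norm_sub_norm_le _ _
    nlinarith
  have hk : 1 / ‖z.1 - z.2‖ ^ ((N : ℝ) + s * p) ≤
      2 ^ ((N : ℝ) + s * p) * ‖z.2‖ ^ (-((N : ℝ) + s * p)) := by
    rw [Real.rpow_neg (norm_nonneg _), ← div_eq_mul_inv,
      ← Real.div_rpow (by norm_num) (norm_nonneg _), one_div, ← Real.inv_rpow (norm_nonneg _)]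
    refine Real.rpow_le_rpow (by positivity) ?_ hq
    rw [inv_eq_one_div, div_le_div_iff₀ (by linarith) hz2]
    linarith
  have r1 : R ^ (-((N : ℝ) - s * p)) * ‖R⁻¹ • z.1‖ ^ (-((N : ℝ) - s * p)) =
      ‖z.1‖ ^ (-((N : ℝ) - s * p)) := by
    rw [← Real.mul_rpow hR.le (norm_nonneg _), norm_smul, Real.norm_of_nonneg (by positivity),
      mul_inv_cancel_left₀ hR.ne']
  have r2 : (M * R) ^ (-((N : ℝ) + s * p)) * ‖(M * R)⁻¹ • z.2‖ ^ (-((N : ℝ) + s * p)) =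
      ‖z.2‖ ^ (-((N : ℝ) + s * p)) := by
    rw [← Real.mul_rpow hMR.le (norm_nonneg _), norm_smul, Real.norm_of_nonneg (by positivity),
      mul_inv_cancel_left₀ hMR.ne']
  calc 1 / ‖z.1 - z.2‖ ^ ((N : ℝ) + s * p) * a
      ≤ (2 ^ ((N : ℝ) + s * p) * ‖z.2‖ ^ (-((N : ℝ) + s * p))) *
        (p * ‖z.1‖ ^ (-((N : ℝ) - s * p))) :=
        (mul_le_mul_of_nonneg_left ha (by positivity)).trans
          (mul_le_mul_of_nonneg_right hk (by positivity))
    _ = _ := by rw [← r1, ← r2]; ring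

/-! ### The lower bound -/

/-- Hölder's inequality for the first variation, with both energies measured in a common unit `e`
so that the powers of `e` add up to one. -/
lemma lintegral_rpow_mul_le_of_gagliardoEnergy_le (hp : 1 < p) (hu : AEMeasurable u)
    (hv : AEMeasurable v) {e : ℝ≥0∞} {A B : ℝ} (hA : 0 ≤ A) (hB : 0 ≤ B)
    (hAu : gagliardoEnergy s p u ≤ ENNReal.ofReal A * e)
    (hBv : gagliardoEnergy s p v ≤ ENNReal.ofReal B * e) :
    ∫⁻ z, ENNReal.ofReal (|u z.1 - u z.2| ^ (p - 1) * |v z.1 - v z.2|)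
      ∂(gagliardoMeasure N s p) ≤
      ENNReal.ofReal (A ^ ((p - 1) / p) * B ^ (1 / p)) * e := by
  have hp0 : 0 < p := by linarith
  have hp1 : 0 < p - 1 := by linarith
  have hpq : (p / (p - 1)).HolderConjugate p := by
    rw [Real.holderConjugate_iff]
    refine ⟨(one_lt_div hp1).mpr (by linarith), ?_⟩
    rw [inv_div]
    field_simp
    ring
  have h := ENNReal.lintegral_mul_le_Lp_mul_Lq (gagliardoMeasure N s p) hpq
    (f := fun z => ENNReal.ofReal (|u z.1 - u z.2| ^ (p - 1)))
    (g := fun z => ENNReal.ofReal |v z.1 - v z.2|)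
    ((aemeasurable_abs_sub hu).pow_const _).ennreal_ofReal
    (aemeasurable_abs_sub hv).ennreal_ofReal
  have e1 : ∀ z : EuclideanSpace ℝ (Fin N) × EuclideanSpace ℝ (Fin N),
      ENNReal.ofReal (|u z.1 - u z.2| ^ (p - 1)) ^ (p / (p - 1)) =
        ENNReal.ofReal (|u z.1 - u z.2| ^ p) := fun z => by
    rw [ENNReal.ofReal_rpow_of_nonneg (by positivity) (by positivity),
      ← Real.rpow_mul (abs_nonneg _), mul_div_cancel₀ _ hp1.ne']
  have e2 : ∀ z : EuclideanSpace ℝ (Fin N) × EuclideanSpace ℝ (Fin N),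
      ENNReal.ofReal |v z.1 - v z.2| ^ p = ENNReal.ofReal (|v z.1 - v z.2| ^ p) := fun z => by
    rw [ENNReal.ofReal_rpow_of_nonneg (abs_nonneg _) hp0.le]
  simp only [e1, e2, ← gagliardoEnergy_eq_lintegral, Pi.mul_apply] at h
  have e3 : ∀ z : EuclideanSpace ℝ (Fin N) × EuclideanSpace ℝ (Fin N),
      ENNReal.ofReal (|u z.1 - u z.2| ^ (p - 1) * |v z.1 - v z.2|) =
        ENNReal.ofReal (|u z.1 - u z.2| ^ (p - 1)) * ENNReal.ofReal |v z.1 - v z.2| :=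
    fun z => ENNReal.ofReal_mul (by positivity)
  simp only [e3]
  have hq : 1 / (p / (p - 1)) = (p - 1) / p := by rw [one_div_div]
  have hq0 : 0 ≤ (p - 1) / p := by positivity
  have hr0 : 0 ≤ 1 / p := by positivity
  rw [hq] at h
  refine h.trans ((mul_le_mul' (ENNReal.rpow_le_rpow hAu hq0)
    (ENNReal.rpow_le_rpow hBv hr0)).trans_eq ?_)
  rw [ENNReal.mul_rpow_of_nonneg _ _ hq0, ENNReal.mul_rpow_of_nonneg _ _ hr0, mul_mul_mul_comm,
    ← ENNReal.rpow_add_of_nonneg _ _ hq0 hr0, ENNReal.ofReal_rpow_of_nonneg hA hq0,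
    ENNReal.ofReal_rpow_of_nonneg hB hr0, ← ENNReal.ofReal_mul (by positivity)]
  have : (p - 1) / p + 1 / p = 1 := by field_simp; ring
  rw [this, ENNReal.rpow_one]

/-- The rescaled potential `v x = u (x / (M R))`, which equals one on the ball of radius `M R`, is
inserted into the first variation of the energy. A pair with both points at distance at least `R`
from the origin only sees the truncation `min u t`, and the remaining pairs that contribute have
one point in the ball of radius `R` and the other outside the ball of radius `M R`. -/
lemma IsCapacitaryPotential.gagliardoEnergy_le_of_ae_le (hs0 : 0 < s) (hp : 1 < p)
    (hsp : s * p < N) (hu : IsCapacitaryPotential s p 1 u) {t M : ℝ} (ht0 : 0 ≤ t) (ht1 : t ≤ 1)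
    (hM : 2 ≤ M) (hR : 1 ≤ R) (ht : ∀ᵐ x, R ≤ ‖x‖ → u x ≤ t) :
    gagliardoEnergy s p u ≤
      ENNReal.ofReal ((p * t) ^ ((p - 1) / p) * ((M * R) ^ ((N : ℝ) - s * p)) ^ (1 / p)) *
        gagliardoEnergy s p u +
      2 * (ENNReal.ofReal (2 ^ ((N : ℝ) + s * p) * p * M ^ (-(s * p))) *
        ((∫⁻ x, innerProfile N s p x) * ∫⁻ x, tailProfile N s p x)) := by
  have hR0 : 0 < R := by linarith
  have hM0 : 0 < M := by linarith
  have hMR : 0 < M * R := by positivity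
  have hMR1 : 1 ≤ M * R := by nlinarith
  have hMRR : R ≤ M * R := by nlinarith
  have hp0 : 0 < p := by linarith
  have hp1 : 0 ≤ p - 1 := by linarith
  have hum := aemeasurable_of_mem_capacityAdmissible hu.1
  obtain ⟨G, hGae, hG⟩ := hu.exists_ae_antitone hs0 hp hsp
  have hc : 0 < (M * R)⁻¹ := by positivity
  set v : EuclideanSpace ℝ (Fin N) → ℝ := fun x => u ((M * R)⁻¹ • x) with hv
  have hvadm : v ∈ capacityAdmissible N s p (M * R) := by
    have := comp_similarity_mem_capacityAdmissible hc (LinearIsometryEquiv.refl ℝ _) hu.1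
    rwa [one_div, inv_inv] at this
  have hvm := aemeasurable_of_mem_capacityAdmissible hvadm
  have hv1 : ∀ᵐ x, v x ≤ 1 := (quasiMeasurePreserving_smul_linearIsometryEquiv hc
    (LinearIsometryEquiv.refl ℝ _)).ae (hu.ae_le_one hs0 hp hsp)
  have hvE : gagliardoEnergy s p v =
      ENNReal.ofReal ((M * R) ^ ((N : ℝ) - s * p)) * gagliardoEnergy s p u := by
    rw [hv, gagliardoEnergy_comp_smul hc, Real.inv_rpow hMR.le, ← Real.rpow_neg hMR.le, neg_sub]
  have hvar := hu.gagliardoEnergy_le_lintegral hp (capacityAdmissible_anti hMR1 hvadm)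
  refine hvar.trans ?_
  have hhold := lintegral_rpow_mul_le_of_gagliardoEnergy_le (s := s) hp
    (hum.min (aemeasurable_const (b := t))) hvm (by positivity : 0 ≤ p * t)
    (by positivity : 0 ≤ (M * R) ^ ((N : ℝ) - s * p))
    (hu.gagliardoEnergy_min_le hp ht0 ht1) hvE.le
  set H := interactionMajorant N s p M R with hH
  have hHm : Measurable H := measurable_interactionMajorant
  -- the second point of a pair may be the inner one, whence the swapped majorant
  have hpt : ∀ᵐ z ∂((volume : Measure (EuclideanSpace ℝ (Fin N))).prod volume),
      ENNReal.ofReal (1 / ‖z.1 - z.2‖ ^ ((N : ℝ) + s * p)) *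
        ENNReal.ofReal (|u z.1 - u z.2| ^ (p - 1) * |v z.1 - v z.2|) ≤
      ENNReal.ofReal (1 / ‖z.1 - z.2‖ ^ ((N : ℝ) + s * p)) *
        ENNReal.ofReal (|min (u z.1) t - min (u z.2) t| ^ (p - 1) * |v z.1 - v z.2|) +
      (H z + H z.swap) := by
    have hgood : ∀ᵐ x, x ∈ G ∧ (R ≤ ‖x‖ → u x ≤ t) ∧ 0 ≤ u x ∧ 0 ≤ v x ∧ v x ≤ 1 ∧
        (x ∈ Metric.ball 0 (M * R) → 1 ≤ v x) ∧
        u x ^ (p - 1) ≤ p * ‖x‖ ^ (-((N : ℝ) - s * p)) := by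
      filter_upwards [hGae, ht, ae_nonneg_of_mem_capacityAdmissible hu.1,
        ae_nonneg_of_mem_capacityAdmissible hvadm, hv1,
        ae_one_le_of_mem_capacityAdmissible hvadm, hu.ae_rpow_le hs0 hp hsp]
        with x h1 h2 h3 h4 h5 h6 h7 using ⟨h1, h2, h3, h4, h5, h6, h7⟩
    have hfar : ∀ z : EuclideanSpace ℝ (Fin N) × EuclideanSpace ℝ (Fin N),
        z.1 ∈ G → z.2 ∈ G → 0 ≤ u z.2 → 0 ≤ v z.1 → v z.1 ≤ 1 → 0 ≤ v z.2 → v z.2 ≤ 1 →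
        u z.1 ^ (p - 1) ≤ p * ‖z.1‖ ^ (-((N : ℝ) - s * p)) → ‖z.1‖ < R → M * R ≤ ‖z.2‖ →
        ENNReal.ofReal (1 / ‖z.1 - z.2‖ ^ ((N : ℝ) + s * p)) *
          ENNReal.ofReal (|u z.1 - u z.2| ^ (p - 1) * |v z.1 - v z.2|) ≤ H z := by
      intro z hz1 hz2 hu2 h1 h2 h3 h4 h5 h6 h7
      refine kernel_mul_le_interactionMajorant hs0 hp hM hR0 h6 h7 (le_trans ?_ h5)
      have hle := hG z.1 hz1 z.2 hz2 (by linarith)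
      have hb : |v z.1 - v z.2| ≤ 1 := abs_le.mpr ⟨by linarith, by linarith⟩
      have ha : |u z.1 - u z.2| ^ (p - 1) ≤ u z.1 ^ (p - 1) := by
        refine Real.rpow_le_rpow (abs_nonneg _) ?_ hp1
        rw [abs_of_nonneg (by linarith)]
        linarith
      exact (mul_le_of_le_one_right (by positivity) hb).trans ha
    filter_upwards [Measure.quasiMeasurePreserving_fst.ae hgood,
      Measure.quasiMeasurePreserving_snd.ae hgood] with z hz1 hz2
    obtain ⟨a1, a2, a3, a4, a5, a6, a7⟩ := hz1
    obtain ⟨b1, b2, b3, b4, b5, b6, b7⟩ := hz2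
    have hnear : z.1 ∈ Metric.ball 0 (M * R) → z.2 ∈ Metric.ball 0 (M * R) →
        |v z.1 - v z.2| = 0 := fun h1 h2 => by
      rw [le_antisymm a5 (a6 h1), le_antisymm b5 (b6 h2), sub_self, abs_zero]
    rcases lt_or_ge ‖z.1‖ R with h1 | h1
    · rcases lt_or_ge ‖z.2‖ (M * R) with h2 | h2
      · rw [hnear (mem_ball_zero_iff.mpr (by linarith)) (mem_ball_zero_iff.mpr h2)]
        simp
      · exact (hfar z a1 b1 b3 a4 a5 b4 b5 a7 h1 h2).trans (le_self_add.trans le_add_self)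
    rcases lt_or_ge ‖z.2‖ R with h2 | h2
    · rcases lt_or_ge ‖z.1‖ (M * R) with h3 | h3
      · rw [hnear (mem_ball_zero_iff.mpr h3) (mem_ball_zero_iff.mpr (by linarith))]
        simp
      · have := hfar z.swap b1 a1 a3 b4 b5 a4 a5 b7 h2 h3
        simp only [Prod.fst_swap, Prod.snd_swap] at this
        rw [norm_sub_rev, abs_sub_comm (u z.2), abs_sub_comm (v z.2)] at this
        exact this.trans (le_add_self.trans le_add_self)
    · rw [min_eq_left (a2 h1), min_eq_left (b2 h2)]
      exact le_self_add
  rw [lintegral_gagliardoMeasure] at hhold ⊢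
  refine (lintegral_mono_ae hpt).trans ?_
  rw [lintegral_add_right (g := fun z => H z + H z.swap) _ (hHm.add (hHm.comp measurable_swap)),
    lintegral_add_left hHm,
    lintegral_prod_swap H, ← two_mul]
  refine add_le_add hhold (mul_le_mul_right (le_of_eq ?_) _)
  exact lintegral_interactionMajorant hp hM0 hR0

/-- The lower bound. The constant may depend on `u`: potentials are unique. -/
theorem IsCapacitaryPotential.exists_lower_bound (hs0 : 0 < s) (hp : 1 < p) (hsp : s * p < N)
    (hu : IsCapacitaryPotential s p 1 u) :
    ∃ C : ℝ, 1 < C ∧ ∀ᵐ x, 1 ≤ ‖x‖ → ‖x‖ ^ (-(((N : ℝ) - s * p) / (p - 1))) / C ≤ u x := by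
  have hp0 : 0 < p := by linarith
  have hp1 : 0 < p - 1 := by linarith
  have hd : 0 < (N : ℝ) - s * p := by linarith
  have hspp : 0 < s * p := by positivity
  obtain ⟨G, hGae, hG⟩ := hu.exists_ae_antitone hs0 hp hsp
  have hE0 := hu.gagliardoEnergy_ne_zero hs0 hp hsp zero_lt_one
  have hEt := hu.1.1.2.ne
  set K : ℝ≥0∞ := (∫⁻ x, innerProfile N s p x) * ∫⁻ x, tailProfile N s p x with hK
  have hKt : K ≠ ⊤ := (ENNReal.mul_lt_top (lintegral_innerProfile_lt_top hs0 hp hsp)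
    (lintegral_tailProfile_lt_top hs0 hp)).ne
  set e : ℝ := (gagliardoEnergy s p u).toReal with he
  have he0 : 0 < e := ENNReal.toReal_pos hE0 hEt
  set D : ℝ := 2 * (2 ^ ((N : ℝ) + s * p) * p * K.toReal) with hD
  -- `M` is so large that the interaction across the annulus is at most half of the energy
  obtain ⟨M, hM2, hMD⟩ : ∃ M : ℝ, 2 ≤ M ∧ D * M ^ (-(s * p)) ≤ e / 2 := by
    have hlim : Tendsto (fun M : ℝ => D * M ^ (-(s * p))) atTop (𝓝 (D * 0)) :=
      (tendsto_rpow_neg_atTop hspp).const_mul D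
    rw [mul_zero] at hlim
    exact ((eventually_ge_atTop 2).and (hlim.eventually_le_const (by positivity))).exists
  have hM0 : 0 < M := by linarith
  set β : ℝ := ((N : ℝ) - s * p) / (p - 1) with hβ
  have hβ0 : 0 < β := by positivity
  set C : ℝ := p * 2 ^ (p / (p - 1)) * M ^ β with hC
  have hCpos : 0 < C := by positivity
  refine ⟨C, ?_, ?_⟩
  · have h1 : 1 ≤ (2 : ℝ) ^ (p / (p - 1)) := Real.one_le_rpow (by norm_num) (by positivity)
    have h2 : 1 ≤ M ^ β := Real.one_le_rpow (by linarith) hβ0.le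
    calc 1 < p := hp
      _ ≤ p * 2 ^ (p / (p - 1)) := le_mul_of_one_le_right hp0.le h1
      _ ≤ C := le_mul_of_one_le_right (by positivity) h2
  filter_upwards [hGae, hu.ae_le_one hs0 hp hsp, ae_nonneg_of_mem_capacityAdmissible hu.1]
    with x hxG hx1 hx0 hR
  have hR0 : 0 < ‖x‖ := by linarith
  have hMR : 0 < M * ‖x‖ := by positivity
  have hkey := hu.gagliardoEnergy_le_of_ae_le hs0 hp hsp hx0 hx1 hM2 hR
    (by filter_upwards [hGae] with y hy hxy using hG x hxG y hy hxy)
  set A : ℝ := (p * u x) ^ ((p - 1) / p) * ((M * ‖x‖) ^ ((N : ℝ) - s * p)) ^ (1 / p) with hA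
  have hA0 : 0 ≤ A := by positivity
  -- the inequality between real numbers
  have hreal : e ≤ A * e + D * M ^ (-(s * p)) := by
    have h := ENNReal.toReal_mono (by
      refine ENNReal.add_ne_top.mpr ⟨ENNReal.mul_ne_top ENNReal.ofReal_ne_top hEt,
        ENNReal.mul_ne_top (by simp) (ENNReal.mul_ne_top ENNReal.ofReal_ne_top hKt)⟩) hkey
    rw [ENNReal.toReal_add (ENNReal.mul_ne_top ENNReal.ofReal_ne_top hEt)
      (ENNReal.mul_ne_top (by simp) (ENNReal.mul_ne_top ENNReal.ofReal_ne_top hKt)),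
      ENNReal.toReal_mul, ENNReal.toReal_mul, ENNReal.toReal_mul, ENNReal.toReal_ofReal hA0,
      ENNReal.toReal_ofReal (by positivity), ENNReal.toReal_ofNat] at h
    refine h.trans (le_of_eq ?_)
    rw [hD]
    ring
  have hhalf : 1 / 2 ≤ A := by
    refine le_of_mul_le_mul_right ?_ he0
    linarith
  have hpow := Real.rpow_le_rpow (by norm_num) hhalf (by positivity : 0 ≤ p / (p - 1))
  have hAq : A ^ (p / (p - 1)) = p * u x * (M ^ β * ‖x‖ ^ β) := by
    rw [hA, Real.mul_rpow (by positivity) (by positivity), ← Real.rpow_mul (by positivity),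
      ← Real.rpow_mul (by positivity), ← Real.rpow_mul (by positivity)]
    have e1 : (p - 1) / p * (p / (p - 1)) = 1 := by field_simp
    have e2 : ((N : ℝ) - s * p) * (1 / p * (p / (p - 1))) = β := by rw [hβ]; field_simp
    rw [e1, e2, Real.rpow_one, Real.mul_rpow hM0.le hR0.le]
  rw [hAq, Real.div_rpow (by norm_num) (by norm_num), Real.one_rpow,
    div_le_iff₀ (by positivity)] at hpow
  have hRβ : 0 < ‖x‖ ^ β := by positivity
  rw [Real.rpow_neg hR0.le, div_le_iff₀ hCpos, inv_le_iff_one_le_mul₀ hRβ]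
  refine hpow.trans (le_of_eq ?_)
  rw [hC]
  ring

/-! ### From almost every point to every point -/

lemma mem_closure_inter_of_ae {U : Set (EuclideanSpace ℝ (Fin N))} (hU : IsOpen U)
    {P : EuclideanSpace ℝ (Fin N) → Prop} (hP : ∀ᵐ x, P x) {x : EuclideanSpace ℝ (Fin N)}
    (hx : x ∈ closure U) : (𝓝[U ∩ {y | P y}] x).NeBot := by
  rw [← mem_closure_iff_nhdsWithin_neBot]
  exact closure_minimal ((Measure.dense_of_ae hP).open_subset_closure_inter hU) isClosed_closure hx

lemma isOpen_setOf_norm_lt_norm (x : EuclideanSpace ℝ (Fin N)) :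
    IsOpen {y : EuclideanSpace ℝ (Fin N) | ‖x‖ < ‖y‖} :=
  isOpen_lt continuous_const continuous_norm

lemma mem_closure_setOf_norm_lt_norm {x : EuclideanSpace ℝ (Fin N)} (hx : ‖x‖ ≠ 0) :
    x ∈ closure {y | ‖x‖ < ‖y‖} := by
  have : {y : EuclideanSpace ℝ (Fin N) | ‖x‖ < ‖y‖} = (Metric.closedBall 0 ‖x‖)ᶜ := by
    ext y; simp
  rw [this, closure_compl, interior_closedBall _ hx]
  simp

lemma tendsto_norm_rpow {x : EuclideanSpace ℝ (Fin N)} (hx : ‖x‖ ≠ 0) (a : ℝ) :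
    Tendsto (fun y : EuclideanSpace ℝ (Fin N) => ‖y‖ ^ a) (𝓝 x) (𝓝 (‖x‖ ^ a)) :=
  (continuous_norm.tendsto x).rpow_const (Or.inl hx)

/-- Almost-everywhere bounds hold at every `x` with `1 ≤ ‖x‖` for a function that is continuous
there or radial and non-increasing: `x` is a limit of good points that are farther from the origin,
and of good points that are nearer. In the radial case the nearer points, which may lie in the unit
ball, give the upper bound, so this bound is assumed there too. -/
theorem forall_bounds_of_ae {v : EuclideanSpace ℝ (Fin N) → ℝ} {a b c : ℝ}
    (hlow : ∀ᵐ x, 1 ≤ ‖x‖ → ‖x‖ ^ a / c ≤ v x) (hup : ∀ᵐ x, v x ≤ b * ‖x‖ ^ a)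
    (hv : ContinuousOn v {x | 1 ≤ ‖x‖} ∨ IsRadialNonincreasing v)
    (x : EuclideanSpace ℝ (Fin N)) (hx : 1 ≤ ‖x‖) :
    ‖x‖ ^ a / c ≤ v x ∧ v x ≤ b * ‖x‖ ^ a := by
  have hx0 : ‖x‖ ≠ 0 := by linarith
  have hboth := hlow.and hup
  have hout := mem_closure_inter_of_ae (isOpen_setOf_norm_lt_norm x) hboth
    (mem_closure_setOf_norm_lt_norm hx0)
  set l := 𝓝[{y | ‖x‖ < ‖y‖} ∩ {y | (1 ≤ ‖y‖ → ‖y‖ ^ a / c ≤ v y) ∧ v y ≤ b * ‖y‖ ^ a}] x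
    with hl
  have hpow : Tendsto (fun y => ‖y‖ ^ a) l (𝓝 (‖x‖ ^ a)) :=
    (tendsto_norm_rpow hx0 a).mono_left nhdsWithin_le_nhds
  rcases hv with hv | hv
  · have hvl : Tendsto v l (𝓝 (v x)) :=
      (hv x hx).mono_left (nhdsWithin_mono x fun y hy => hx.trans (le_of_lt hy.1))
    constructor
    · refine le_of_tendsto_of_tendsto (hpow.div_const c) hvl ?_
      filter_upwards [self_mem_nhdsWithin] with y hy using hy.2.1 (hx.trans (le_of_lt hy.1))
    · refine le_of_tendsto_of_tendsto hvl (hpow.const_mul b) ?_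
      filter_upwards [self_mem_nhdsWithin] with y hy using hy.2.2
  · constructor
    · refine le_of_tendsto (hpow.div_const c) ?_
      filter_upwards [self_mem_nhdsWithin] with y hy
      exact (hy.2.1 (hx.trans (le_of_lt hy.1))).trans (hv x y (le_of_lt hy.1))
    · have hin := mem_closure_inter_of_ae Metric.isOpen_ball hup
        (x := x) (U := Metric.ball 0 ‖x‖) (by rw [closure_ball _ hx0]; simp)
      have hpow' : Tendsto (fun y => ‖y‖ ^ a)
          (𝓝[Metric.ball 0 ‖x‖ ∩ {y | v y ≤ b * ‖y‖ ^ a}] x) (𝓝 (‖x‖ ^ a)) :=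
        (tendsto_norm_rpow hx0 a).mono_left nhdsWithin_le_nhds
      refine ge_of_tendsto (hpow'.const_mul b) ?_
      filter_upwards [self_mem_nhdsWithin] with y hy
      exact (hv y x (mem_ball_zero_iff.mp hy.1).le).trans hy.2

lemma IsCapacitaryPotential.ae_le (hs0 : 0 < s) (hp : 1 < p) (hsp : s * p < N)
    (hu : IsCapacitaryPotential s p 1 u) :
    ∀ᵐ x, u x ≤ p ^ (1 / (p - 1)) * ‖x‖ ^ (-(((N : ℝ) - s * p) / (p - 1))) := by
  have hp1 : 0 < p - 1 := by linarith
  filter_upwards [hu.ae_rpow_le hs0 hp hsp, ae_nonneg_of_mem_capacityAdmissible hu.1] with x h h0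
  have := Real.rpow_le_rpow (by positivity) h (by positivity : 0 ≤ 1 / (p - 1))
  rwa [← Real.rpow_mul h0, mul_one_div_cancel hp1.ne', Real.rpow_one,
    Real.mul_rpow (by linarith) (by positivity), ← Real.rpow_mul (norm_nonneg _),
    mul_one_div, neg_div] at this

end CapacitaryPotential

theorem mainTheorem7 (N : ℕ) (s p : ℝ) (hs0 : 0 < s) (hs1 : s < 1) (hp : 1 < p)
    (hsp : s * p < N) :
    ∃ C : ℝ, 1 < C ∧
      ∀ u : EuclideanSpace ℝ (Fin N) → ℝ, IsCapacitaryPotential s p 1 u →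
        (∀ᵐ x : EuclideanSpace ℝ (Fin N), 1 ≤ ‖x‖ →
          ‖x‖ ^ (-((N - s * p) / (p - 1))) / C ≤ u x ∧
          u x ≤ p ^ (1 / (p - 1)) * ‖x‖ ^ (-((N - s * p) / (p - 1)))) ∧
        (∀ v : EuclideanSpace ℝ (Fin N) → ℝ, v =ᵐ[volume] u →
          (ContinuousOn v {x | 1 ≤ ‖x‖} ∨ IsRadialNonincreasing v) →
          ∀ x : EuclideanSpace ℝ (Fin N), 1 ≤ ‖x‖ →
            ‖x‖ ^ (-((N - s * p) / (p - 1))) / C ≤ v x ∧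
            v x ≤ p ^ (1 / (p - 1)) * ‖x‖ ^ (-((N - s * p) / (p - 1)))) := by
  by_cases hex : ∃ u₀ : EuclideanSpace ℝ (Fin N) → ℝ, IsCapacitaryPotential s p 1 u₀
  swap
  · exact ⟨2, one_lt_two, fun u hu => absurd ⟨u, hu⟩ hex⟩
  obtain ⟨u₀, hu₀⟩ := hex
  obtain ⟨C, hC1, hlow₀⟩ := hu₀.exists_lower_bound hs0 hp hsp
  refine ⟨C, hC1, fun u hu => ?_⟩
  -- by uniqueness the constant found for `u₀` serves every potential
  have hlow : ∀ᵐ x, 1 ≤ ‖x‖ → ‖x‖ ^ (-(((N : ℝ) - s * p) / (p - 1))) / C ≤ u x := by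
    filter_upwards [hlow₀, hu₀.ae_eq hs0 hp hsp hu] with x h h' using h' ▸ h
  have hup := hu.ae_le hs0 hp hsp
  refine ⟨?_, fun v hv hreg => forall_bounds_of_ae ?_ ?_ hreg⟩
  · filter_upwards [hlow, hup] with x h1 h2 hx using ⟨h1 hx, h2⟩
  · filter_upwards [hlow, hv] with x h h' using h' ▸ h
  · filter_upwards [hup, hv] with x h h' using h' ▸ h
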